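/- Let $X$ be a compact manifold, $\phi_t : X \to X$ $(t\in\mathbb R)$ a $C^\infty$ flow preserving a finite Borel measure $dx$, and $\pi : S \to X$ a smooth real vector bundle of finite rank with a smooth symplectic form $\omega$ on its fibres. Let $J$ be an almost complex structure on $S$ compatible with $\omega$ (that is, $J^2=-\mathrm{Id}$, $\omega(Jv,Jw)=\omega(v,w)$ and $\omega(v,Jv)>0$ for $v \ne 0$) such that the metric $g_J(v,w)=\omega(v,Jw)$ is continuous, and give the fibres of $S$ the inner products $g_J$. For a linear map $L:E\to G$ of finite-dimensional Euclidean spaces put $|\det L| = \sqrt{\det(\langle Lv_i,Lv_j\rangle)_{i,j}}$, where $(v_i)$ is an orthonormal basis of $E$, and let $\mathrm{ex}\,L=\max_{W\subset E}|\det L|_W|$, the maximum over all linear subspaces $W$ of $E$. Let $\phi_t^*(x):S(x)\to S(\phi_t(x))$, $x \in X$, $t\in\mathbb R$, be a linear symplectic cocycle over $\phi_t$: each $\phi^*_t(x)$ is a linear symplectic isomorphism, $\phi^*_{t+s}(x)=\phi^*_t(\phi_s(x))\,\phi^*_s(x)$, and $(t,v)\mapsto\phi_t^*(\pi(v))\,v$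 is a differentiable map $\mathbb R\times S\to S$. Let $x\mapsto\alpha(x)\subset S(x)$ be a continuous Lagrangian distribution. Suppose that the cocycle is optical with respect to $\alpha$: for every $x\in X$ the curve $\lambda_x(t)=\phi_t^*(\phi_{-t}(x))\,\alpha(\phi_{-t}(x))$ of Lagrangian subspaces of $S(x)$ is differentiable at $t=0$ and its velocity there is $\alpha(x)$-positive, i.e. for $t$ near $0$ one can write $\lambda_x(t)=T(t)\,\alpha(x)$ with $T(t)$ a linear symplectic automorphism of $S(x)$, $T(0)=\mathrm{Id}$, $T$ differentiable at $0$, and the form $(\zeta,\eta)\mapsto\omega(\zeta,\dot T(0)\eta)$ is positive definite on $\alpha(x)$. Then there is a constant $C>0$ such that for all $t\in\mathbb R$ the functions $x\mapsto|\det\phi_t^*(x)|_{\alpha(x)}|$ and $x\mapsto\mathrm{ex}\,\phi_t^*(x)$ are integrable on $X$ and $$\int_X\big|\det\phi_t^*(x)|_{\alpha(x)}\big|\,dx\;\ge\;C\int_X\mathrm{ex}\,\phi_t^*(x)\,dx .$$ -/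

import Mathlib

open Bundle Filter Topology MeasureTheory
open scoped Manifold ContDiff

noncomputable section

section LinearAlgebra

variable {E G : Type*} [NormedAddCommGroup E] [InnerProductSpace ℝ E]
  [NormedAddCommGroup G] [InnerProductSpace ℝ G]

/-- `|det L|` for a linear map between finite-dimensional Euclidean spaces: the square root of the
determinant of the matrix `⟪L vᵢ, L vⱼ⟫`, where `v` is an orthonormal basis of the domain. -/
def absDet [FiniteDimensional ℝ E] (L : E →ₗ[ℝ] G) : ℝ :=
  √ (Matrix.of fun i j : Fin (Module.finrank ℝ E) =>
    inner ℝ (L (stdOrthonormalBasis ℝ E i)) (L (stdOrthonormalBasis ℝ E j))).det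

/-- The expansion `ex L`: the maximum of `|det L|_W|` over all linear subspaces `W` (of every
dimension) of the domain. -/
def expansion [FiniteDimensional ℝ E] (L : E →ₗ[ℝ] G) : ℝ :=
  ⨆ W : Submodule ℝ E, absDet (L.domRestrict W)

/-- The supremum defining the expansion is over a bounded family. -/
theorem bddAbove_absDet_domRestrict [FiniteDimensional ℝ E] (L : E →ₗ[ℝ] G) :
    BddAbove (Set.range fun W : Submodule ℝ E => absDet (L.domRestrict W)) := by
  set M : ℝ := max 1 (‖LinearMap.toContinuousLinearMap L‖ ^ 2)
  have hM : 1 ≤ M := le_max_left _ _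
  refine ⟨√ ((Nat.factorial (Module.finrank ℝ E) : ℝ) * M ^ (Module.finrank ℝ E)), ?_⟩
  rintro _ ⟨W, rfl⟩
  refine Real.sqrt_le_sqrt ((le_abs_self _).trans ((Matrix.det_le (abv := AbsoluteValue.abs) (x := M) ?_).trans ?_))
  · intro i j
    have h : ∀ i, ‖L.domRestrict W (stdOrthonormalBasis ℝ W i)‖ ≤ ‖LinearMap.toContinuousLinearMap L‖ := fun i => by
      have := (LinearMap.toContinuousLinearMap L).le_opNorm (stdOrthonormalBasis ℝ W i : E)
      have h1 : ‖(stdOrthonormalBasis ℝ W i : E)‖ = 1 := (stdOrthonormalBasis ℝ W).orthonormal.1 i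
      simpa [h1] using this
    refine (abs_real_inner_le_norm _ _).trans ((mul_le_mul (h i) (h j) (norm_nonneg _) (norm_nonneg _)).trans ?_)
    rw [← sq]; exact le_max_right _ _
  · have hk : Module.finrank ℝ W ≤ Module.finrank ℝ E := W.finrank_le
    simp only [Fintype.card_fin, nsmul_eq_mul]
    have := Nat.factorial_le hk
    gcongr

/-- A subspace is Lagrangian if it is equal to its own `σ`-orthogonal complement. -/
def IsLagrangian (σ : E →L[ℝ] E →L[ℝ] ℝ) (W : Submodule ℝ E) : Prop :=
  ∀ v, v ∈ W ↔ ∀ w ∈ W, σ v w = 0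

/-- The curve `Γ` of Lagrangian subspaces is differentiable at time `0` and its velocity there is
an `α`-positive vector: near `0` one can write `Γ t = T t (Γ 0)` with `T t` symplectic, `T 0 = id`
and `T` differentiable at `0`, and the symmetric form `(ζ, η) ↦ σ (ζ, T'(0) η)` on `Γ 0`, which
represents the velocity of `Γ`, is positive definite on `α ∩ Γ 0`. -/
def IsPositiveAtZero (σ : E →L[ℝ] E →L[ℝ] ℝ) (α : Submodule ℝ E)
    (Γ : ℝ → Submodule ℝ E) : Prop :=
  ∃ (T : ℝ → E →L[ℝ] E) (T' : E →L[ℝ] E),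
    T 0 = ContinuousLinearMap.id ℝ E ∧
    (∀ t v w, σ (T t v) (T t w) = σ v w) ∧
    HasDerivAt T T' 0 ∧
    (∀ᶠ t in 𝓝 (0 : ℝ), Γ t = (Γ 0).map (T t : E →ₗ[ℝ] E)) ∧
    ∀ ζ ∈ α ⊓ Γ 0, ζ ≠ 0 → 0 < σ ζ (T' ζ)

end LinearAlgebra

section Bundles

variable {EX H X : Type*} [NormedAddCommGroup EX] [NormedSpace ℝ EX] [TopologicalSpace H]
  (I : ModelWithCorners ℝ EX H) [TopologicalSpace X] [ChartedSpace H X]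
  (F : Type*) [NormedAddCommGroup F] [NormedSpace ℝ F]
  (S : X → Type*) [TopologicalSpace (TotalSpace F S)]
  [∀ x, NormedAddCommGroup (S x)] [∀ x, InnerProductSpace ℝ (S x)]
  [FiberBundle F S] [VectorBundle ℝ F S]

/-- A smooth field of symplectic forms on the fibres of the vector bundle `S`. -/
structure SymplecticForm where
  form : ∀ x, S x →L[ℝ] S x →L[ℝ] ℝ
  alternating : ∀ x v, form x v v = 0
  nondegenerate : ∀ x v, (∀ w, form x v w = 0) → v = 0
  contMDiff : ContMDiff I (I.prod 𝓘(ℝ, F →L[ℝ] F →L[ℝ] ℝ)) ∞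
    (fun x => TotalSpace.mk' (F →L[ℝ] F →L[ℝ] ℝ) (E := fun x => S x →L[ℝ] S x →L[ℝ] ℝ) x (form x))

variable {I F S}

/-- The almost complex structure `J` is compatible with `σ`, and the Euclidean metric on the
fibres of `S` is the metric `g_J (v, w) = σ (v, J w)` it defines. -/
structure IsCompatible (σ : SymplecticForm I F S) (J : ∀ x, S x →ₗ[ℝ] S x) : Prop where
  sq : ∀ x v, J x (J x v) = -v
  invariant : ∀ x v w, σ.form x (J x v) (J x w) = σ.form x v w
  pos : ∀ x v, v ≠ 0 → 0 < σ.form x v (J x v)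
  metric : ∀ x v w, inner ℝ v w = σ.form x v (J x w)

variable (F) in
/-- A field of subspaces `α x ⊆ S x` is continuous if it has a continuous frame near each point. -/
def IsContinuousDistribution (α : ∀ x, Submodule ℝ (S x)) : Prop :=
  ∀ x₀ : X, ∃ U ∈ 𝓝 x₀, ∃ (k : ℕ) (e : Fin k → ∀ x, S x),
    (∀ i, ContinuousOn (fun x => (⟨x, e i x⟩ : TotalSpace F S)) U) ∧
    ∀ x ∈ U, LinearIndependent ℝ (fun i => e i x) ∧
      Submodule.span ℝ (Set.range fun i => e i x) = α x

/-- A linear symplectic cocycle over the flow `φ`, differentiable as a map `ℝ × S → S`.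
The type of `map` says that the cocycle covers `φ`; the cocycle identity is stated in the total
space of `S`, as `φ (t + s) x` and `φ t (φ s x)` are only propositionally equal. -/
structure SymplecticCocycle (σ : SymplecticForm I F S) (φ : Flow ℝ X) where
  map : ∀ (t : ℝ) (x : X), S x ≃ₗ[ℝ] S (φ t x)
  map_add : ∀ (t s : ℝ) (x : X) (v : S x),
    (⟨φ (t + s) x, map (t + s) x v⟩ : TotalSpace F S) =
      ⟨φ t (φ s x), map t (φ s x) (map s x v)⟩
  symplectic : ∀ (t : ℝ) (x : X) (v w : S x),
    σ.form (φ t x) (map t x v) (map t x w) = σ.form x v w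
  mdifferentiable : MDifferentiable (𝓘(ℝ, ℝ).prod (I.prod 𝓘(ℝ, F))) (I.prod 𝓘(ℝ, F))
    (fun p : ℝ × TotalSpace F S =>
      (⟨φ p.1 p.2.proj, map p.1 p.2.proj p.2.snd⟩ : TotalSpace F S))

/-- The identification of the fibres over two equal base points. -/
def fibreCast {x y : X} (h : x = y) : S x ≃ₗ[ℝ] S y :=
  h ▸ LinearEquiv.refl ℝ (S x)

theorem flow_neg_cancel (φ : Flow ℝ X) (t : ℝ) (x : X) : φ t (φ (-t) x) = x := by
  rw [← φ.map_add, add_neg_cancel, φ.map_zero_apply]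

/-- The curve `t ↦ (φ_t)_* (α (φ_{-t} x))` of subspaces of `S x`. -/
def SymplecticCocycle.pushforward {σ : SymplecticForm I F S} {φ : Flow ℝ X}
    (A : SymplecticCocycle σ φ) (α : ∀ x, Submodule ℝ (S x)) (x : X) (t : ℝ) :
    Submodule ℝ (S x) :=
  (α (φ (-t) x)).map
    ((A.map t (φ (-t) x)).trans (fibreCast (flow_neg_cancel φ t x)) : S (φ (-t) x) →ₗ[ℝ] S x)

/-- The cocycle is optical with respect to `α`: for every `x` the velocity at `t = 0` of the curve
`(φ_t)_* (α (φ_{-t} x))` exists and is `α x`-positive. -/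
def SymplecticCocycle.IsOptical {σ : SymplecticForm I F S} {φ : Flow ℝ X}
    (A : SymplecticCocycle σ φ) (α : ∀ x, Submodule ℝ (S x)) : Prop :=
  ∀ x, IsPositiveAtZero (σ.form x) (α x) (A.pushforward α x)

end Bundles

end

/-! For a linear symplectic map `L`, the operator `P = LᵀL` is positive and satisfies `P J P = J`,
so `J` swaps its eigenvalues `a` and `a⁻¹`. Hence there is an isotropic `P`-invariant `W` with `P ≥
1` on `W` and `Wᗮ = J W`. As `L` expands `W`, contracts `Wᗮ` and keeps them orthogonal, `ex L` is at
most a dimensional constant times `|det L|_W|`. A Lagrangian `Λ` at angle at least `δ` from `V = Wᗮ`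
projects onto `W` with bounded distortion, so `ex L` is also controlled by `|det L|_Λ|`
(`exists_isotropic_expansion_le`).

The subspace `α x` may meet `V`, but by opticality no isotropic subspace meets all its
push-forwards: unit vectors common to `V` and the push-forwards at times tending to `0` would have a
limit on which the velocity form vanishes (`IsPositiveAtZero.false_of_isotropic`). Compactness makes
this uniform: finitely many times `s` and one `δ` serve every `x` and every isotropic `V`
(`exists_uniform`).

Passing from the push-forward at time `s` back to `α` at `φ (-s) x` costs a factor independent of
`t`. So `ex` at `x` is at most a finite sum of constants times the determinants at the points `φ
(-s) x`, and integration with the invariance of the measure finishes. -/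

/-! ### Monotonicity of the determinant on positive semidefinite matrices. -/

open Matrix in
theorem Matrix.PosSemidef.one_le_det_one_add {n : Type*} [Fintype n] [DecidableEq n]
    {C : Matrix n n ℝ} (hC : C.PosSemidef) : 1 ≤ (1 + C).det := by
  have h := hC.1.spectral_theorem
  rw [Unitary.conjStarAlgAut_apply] at h
  have h2 : (1 + C).det = (1 + diagonal hC.1.eigenvalues).det := by
    have hu : star (hC.1.eigenvectorUnitary : Matrix n n ℝ) * hC.1.eigenvectorUnitary = 1 :=
      Unitary.coe_star_mul_self _
    conv_lhs => rw [h, mul_assoc, det_one_add_mul_comm, mul_assoc, hu, mul_one]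
    rfl
  rw [h2, ← diagonal_one, diagonal_add, det_diagonal]
  exact Finset.one_le_prod fun i => by simpa using hC.eigenvalues_nonneg i

open Matrix in
theorem Matrix.PosSemidef.exists_eq_transpose_mul_self {n : Type*} [Fintype n] [DecidableEq n]
    {A : Matrix n n ℝ} (hA : A.PosSemidef) : ∃ B : Matrix n n ℝ, A = Bᵀ * B := by
  have h := hA.1.spectral_theorem
  rw [Unitary.conjStarAlgAut_apply] at h
  refine ⟨diagonal (fun i => √(hA.1.eigenvalues i)) * (hA.1.eigenvectorUnitary : Matrix n n ℝ)ᵀ, ?_⟩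
  conv_lhs => rw [h]
  rw [transpose_mul, transpose_transpose, diagonal_transpose, mul_assoc, mul_assoc,
    ← mul_assoc (diagonal _) (diagonal _), diagonal_mul_diagonal]
  simp only [Real.mul_self_sqrt (hA.eigenvalues_nonneg _)]
  rfl

-- Writing `A = Rᵀ R` with `R` invertible, congruence by `R⁻¹` reduces the claim to `1 ≤ det (1 +
-- C)`. If `R` is singular, the left side is zero.
open Matrix in
theorem Matrix.PosSemidef.det_le_det {n : Type*} [Fintype n] [DecidableEq n]
    {A B : Matrix n n ℝ} (hA : A.PosSemidef) (hAB : (B - A).PosSemidef) : A.det ≤ B.det := by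
  obtain ⟨R, rfl⟩ := hA.exists_eq_transpose_mul_self
  by_cases hR : IsUnit R.det
  · have h1 : B = Rᵀ * (1 + R⁻¹ᵀ * (B - Rᵀ * R) * R⁻¹) * R := by
      have h2 : Rᵀ * R⁻¹ᵀ = 1 := by rw [← transpose_mul, nonsing_inv_mul _ hR, transpose_one]
      calc B = Rᵀ * R + (Rᵀ * R⁻¹ᵀ) * (B - Rᵀ * R) * (R⁻¹ * R) := by
            rw [h2, nonsing_inv_mul _ hR]; simp
        _ = _ := by noncomm_ring
    have h3 := (hAB.conjTranspose_mul_mul_same R⁻¹).one_le_det_one_add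
    rw [conjTranspose_eq_transpose_of_trivial] at h3
    rw [h1, det_mul, det_mul, det_mul]
    have : 0 ≤ Rᵀ.det * R.det := by rw [det_transpose]; exact mul_self_nonneg _
    nlinarith
  · have h0 : R.det = 0 := by simpa using hR
    have hB : B.PosSemidef := by simpa using hA.add hAB
    rw [det_mul, h0, mul_zero]
    exact hB.det_nonneg

/-! ### Gram determinants and volume distortion. -/

section Volume

variable {E E' G G' : Type*} [NormedAddCommGroup E] [InnerProductSpace ℝ E]
  [NormedAddCommGroup E'] [InnerProductSpace ℝ E']
  [NormedAddCommGroup G] [InnerProductSpace ℝ G]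
  [NormedAddCommGroup G'] [InnerProductSpace ℝ G']

open Matrix

theorem absDet_sq [FiniteDimensional ℝ E] (L : E →ₗ[ℝ] G) :
    absDet L ^ 2 = (gram ℝ (L ∘ stdOrthonormalBasis ℝ E)).det :=
  Real.sq_sqrt (posSemidef_gram ℝ _).det_nonneg

theorem absDet_nonneg [FiniteDimensional ℝ E] (L : E →ₗ[ℝ] G) : 0 ≤ absDet L :=
  Real.sqrt_nonneg _

theorem gram_map_orthonormalBasis {ι κ : Type*} [Fintype ι] [Fintype κ]
    (o : OrthonormalBasis ι ℝ E) (L : E →ₗ[ℝ] G) (v : κ → E) :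
    gram ℝ (L ∘ v) = (of fun i j => inner ℝ (o i) (v j))ᵀ * gram ℝ (L ∘ o) *
      (of fun i j => inner ℝ (o i) (v j)) := by
  ext i j
  have h (k : κ) : L (v k) = ∑ a, inner ℝ (o a) (v k) • L (o a) := by
    conv_lhs => rw [← o.sum_repr' (v k)]
    simp
  simp only [gram_apply, Function.comp_apply, mul_apply, transpose_apply, of_apply]
  rw [h i, h j, sum_inner]
  simp only [inner_sum, inner_smul_left, inner_smul_right, Finset.sum_mul]
  rw [Finset.sum_comm]
  refine Finset.sum_congr rfl fun a _ => Finset.sum_congr rfl fun b _ => ?_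
  simp; ring

/-- The Gram determinant of the image of a frame. -/
theorem det_gram_map [FiniteDimensional ℝ E] {ι : Type*} [Fintype ι] [DecidableEq ι]
    (L : E →ₗ[ℝ] G) (v : ι → E) (hι : Fintype.card ι = Module.finrank ℝ E) :
    (gram ℝ (L ∘ v)).det = (gram ℝ v).det * absDet L ^ 2 := by
  let e : ι ≃ Fin (Module.finrank ℝ E) := Fintype.equivFinOfCardEq hι
  let o := (stdOrthonormalBasis ℝ E).reindex e.symm
  have h1 : (gram ℝ (L ∘ o)).det = absDet L ^ 2 := by
    rw [absDet_sq, ← det_submatrix_equiv_self e (gram ℝ (L ∘ stdOrthonormalBasis ℝ E))]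
    congr 1
    ext i j
    simp [o, gram_apply]
  have h2 := gram_map_orthonormalBasis o (LinearMap.id : E →ₗ[ℝ] E) v
  have h3 : gram ℝ o = 1 := by
    ext i j
    rw [gram_apply, orthonormal_iff_ite.1 o.orthonormal, one_apply]
  simp only [LinearMap.id_coe, Function.id_comp, h3, mul_one] at h2
  rw [gram_map_orthonormalBasis o L v, h2, det_mul, det_mul, det_mul, h1]
  ring

theorem absDet_sq_orthonormalBasis [FiniteDimensional ℝ E] {ι : Type*} [Fintype ι] [DecidableEq ι]
    (L : E →ₗ[ℝ] G) (o : OrthonormalBasis ι ℝ E) : absDet L ^ 2 = (gram ℝ (L ∘ o)).det := by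
  have h3 : gram ℝ o = 1 := by
    ext i j
    rw [gram_apply, orthonormal_iff_ite.1 o.orthonormal, one_apply]
  rw [det_gram_map L o (Module.finrank_eq_card_basis o.toBasis).symm, h3, det_one, one_mul]

theorem absDet_id [FiniteDimensional ℝ E] : absDet (LinearMap.id : E →ₗ[ℝ] E) = 1 := by
  have h := absDet_sq_orthonormalBasis (LinearMap.id : E →ₗ[ℝ] E) (stdOrthonormalBasis ℝ E)
  have h2 := det_gram_map (LinearMap.id : E →ₗ[ℝ] E) (stdOrthonormalBasis ℝ E) (by simp)
  have h3 : gram ℝ (stdOrthonormalBasis ℝ E) = 1 := by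
    ext i j
    rw [gram_apply, orthonormal_iff_ite.1 (stdOrthonormalBasis ℝ E).orthonormal, one_apply]
  rw [LinearMap.id_coe, Function.id_comp, h3, det_one] at h
  nlinarith [absDet_nonneg (LinearMap.id : E →ₗ[ℝ] E)]

theorem absDet_comp [FiniteDimensional ℝ E] [FiniteDimensional ℝ E'] (L : E →ₗ[ℝ] G)
    (M : E' →ₗ[ℝ] E) (h : Module.finrank ℝ E' = Module.finrank ℝ E) :
    absDet (L ∘ₗ M) = absDet L * absDet M := by
  have h1 : absDet (L ∘ₗ M) ^ 2 = (absDet L * absDet M) ^ 2 := by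
    rw [absDet_sq, LinearMap.coe_comp, Function.comp_assoc, det_gram_map L _ (by simpa using h),
      ← absDet_sq]
    ring
  exact (sq_eq_sq₀ (absDet_nonneg _) (mul_nonneg (absDet_nonneg _) (absDet_nonneg _))).1 h1

theorem posSemidef_smul_gram_sub {ι : Type*} [Fintype ι] (u : ι → G) (v : ι → G') (c : ℝ)
    (h : ∀ x : ι → ℝ, ‖∑ i, x i • u i‖ ^ 2 ≤ c * ‖∑ i, x i • v i‖ ^ 2) :
    (c • gram ℝ v - gram ℝ u).PosSemidef := by
  refine .of_dotProduct_mulVec_nonneg ?_ fun x => ?_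
  · refine IsHermitian.sub ?_ (isHermitian_gram ℝ u)
    rw [IsHermitian, conjTranspose_smul, (isHermitian_gram ℝ v).eq]; simp
  · rw [sub_mulVec, dotProduct_sub, smul_mulVec, dotProduct_smul, star_dotProduct_gram_mulVec,
      star_dotProduct_gram_mulVec, real_inner_self_eq_norm_sq, real_inner_self_eq_norm_sq,
      smul_eq_mul]
    linarith [h x]

/-- Domination of norms is the Loewner inequality between Gram matrices, so determinants compare.
The targets of the two maps may differ. -/
theorem absDet_le_of_norm_le [FiniteDimensional ℝ E] (L : E →ₗ[ℝ] G) (L' : E →ₗ[ℝ] G') {K : ℝ}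
    (hK : 0 ≤ K) (h : ∀ v, ‖L v‖ ≤ K * ‖L' v‖) :
    absDet L ≤ K ^ Module.finrank ℝ E * absDet L' := by
  have h1 := (posSemidef_gram ℝ (L ∘ stdOrthonormalBasis ℝ E)).det_le_det
    (posSemidef_smul_gram_sub (L ∘ stdOrthonormalBasis ℝ E) (L' ∘ stdOrthonormalBasis ℝ E) (K ^ 2)
      fun x => by
        have := h (∑ i, x i • stdOrthonormalBasis ℝ E i)
        simp only [map_sum, map_smul] at this
        rw [← mul_pow]
        exact pow_le_pow_left₀ (norm_nonneg _) this 2)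
  rw [det_smul, ← absDet_sq, ← absDet_sq, Fintype.card_fin] at h1
  refine le_of_sq_le_sq (h1.trans_eq (by ring)) (mul_nonneg (pow_nonneg hK _) (absDet_nonneg _))

theorem absDet_le_pow [FiniteDimensional ℝ E] (L : E →ₗ[ℝ] G) {K : ℝ}
    (hK : 0 ≤ K) (h : ∀ v, ‖L v‖ ≤ K * ‖v‖) : absDet L ≤ K ^ Module.finrank ℝ E := by
  simpa [absDet_id] using absDet_le_of_norm_le L (LinearMap.id : E →ₗ[ℝ] E) hK h

theorem expansion_nonneg [FiniteDimensional ℝ E] (L : E →ₗ[ℝ] G) : 0 ≤ expansion L :=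
  Real.iSup_nonneg fun _ => absDet_nonneg _

theorem absDet_domRestrict_le_expansion [FiniteDimensional ℝ E] (L : E →ₗ[ℝ] G)
    (W : Submodule ℝ E) : absDet (L.domRestrict W) ≤ expansion L :=
  le_ciSup (bddAbove_absDet_domRestrict L) W

theorem expansion_le_pow [FiniteDimensional ℝ E] (L : E →ₗ[ℝ] G) {K : ℝ}
    (hK : 1 ≤ K) (h : ∀ v, ‖L v‖ ≤ K * ‖v‖) : expansion L ≤ K ^ Module.finrank ℝ E :=
  ciSup_le fun W => (absDet_le_pow (L.domRestrict W) (zero_le_one.trans hK) fun v => h v).trans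
    (pow_le_pow_right₀ hK W.finrank_le)

/-- A Gram determinant is at most `det (1 + Lᵀ L)`. -/
theorem absDet_domRestrict_sq_le_det_one_add [FiniteDimensional ℝ E] {ι : Type*} [Fintype ι]
    [DecidableEq ι] (L : E →ₗ[ℝ] G) (o : OrthonormalBasis ι ℝ E) (W : Submodule ℝ E) :
    absDet (L.domRestrict W) ^ 2 ≤ (1 + gram ℝ (L ∘ o)).det := by
  let w := stdOrthonormalBasis ℝ W
  have hw : L.domRestrict W ∘ w = L ∘ (fun i => (w i : E)) := rfl
  obtain ⟨R, hR⟩ := (posSemidef_gram ℝ (L ∘ o)).exists_eq_transpose_mul_self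
  set X : Matrix ι (Fin (Module.finrank ℝ W)) ℝ := of fun i j => inner ℝ (o i) (w j : E) with hX
  have hXX : Xᵀ * X = 1 := by
    have h := gram_map_orthonormalBasis o (LinearMap.id : E →ₗ[ℝ] E) (fun i => (w i : E))
    have h3 : gram ℝ o = 1 := by
      ext i j
      rw [gram_apply, orthonormal_iff_ite.1 o.orthonormal, one_apply]
    simp only [LinearMap.id_coe, Function.id_comp, h3, Matrix.mul_one] at h
    rw [hX, ← h]
    ext i j
    rw [gram_apply, ← Submodule.coe_inner, orthonormal_iff_ite.1 w.orthonormal, one_apply]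
  -- The columns of `X` are orthonormal, so `X Xᵀ` is an orthogonal projection.
  have hproj : (1 - X * Xᵀ).PosSemidef := by
    have h : (1 - X * Xᵀ) = (1 - X * Xᵀ)ᴴ * (1 - X * Xᵀ) := by
      have : X * Xᵀ * (X * Xᵀ) = X * Xᵀ := by
        rw [Matrix.mul_assoc, ← Matrix.mul_assoc Xᵀ, hXX, Matrix.one_mul]
      rw [conjTranspose_eq_transpose_of_trivial, transpose_sub, transpose_one, transpose_mul,
        transpose_transpose, sub_mul, mul_sub, mul_sub, this]
      simp
    rw [h]
    exact posSemidef_conjTranspose_mul_self _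
  rw [absDet_sq, hw, gram_map_orthonormalBasis o L, ← hX, hR]
  have e1 : Xᵀ * (Rᵀ * R) * X = (R * X)ᵀ * (R * X) := by
    rw [transpose_mul]; simp only [Matrix.mul_assoc]
  have p1 : ((R * X)ᵀ * (R * X)).PosSemidef := by
    simpa using posSemidef_conjTranspose_mul_self (R * X)
  -- The identity `det (1 + M N) = det (1 + N M)` places `X Xᵀ` between `R` and `Rᵀ`, where it can
  -- be bounded by `1`.
  calc (Xᵀ * (Rᵀ * R) * X).det ≤ (1 + (R * X)ᵀ * (R * X)).det := by
        rw [e1]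
        exact p1.det_le_det (by simpa using PosSemidef.one)
    _ = (1 + R * X * (R * X)ᵀ).det := det_one_add_mul_comm _ _
    _ ≤ (1 + R * Rᵀ).det := by
        refine PosSemidef.det_le_det (PosSemidef.one.add ?_) ?_
        · simpa using posSemidef_self_mul_conjTranspose (R * X)
        · have h := hproj.mul_mul_conjTranspose_same R
          convert h using 1
          rw [conjTranspose_eq_transpose_of_trivial, transpose_mul]
          simp only [Matrix.mul_sub, Matrix.sub_mul, Matrix.mul_one, Matrix.mul_assoc]
          abel
    _ = (1 + Rᵀ * R).det := det_one_add_mul_comm _ _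

end Volume

/-! ### Expansion of a linear symplectic map. -/

section Symplectic

variable {E G : Type*} [NormedAddCommGroup E] [InnerProductSpace ℝ E]
  [NormedAddCommGroup G] [InnerProductSpace ℝ G]

/-- An orthogonal complex structure on a Euclidean space. -/
structure IsOrthogonalComplex (J : E →ₗ[ℝ] E) : Prop where
  sq : ∀ v, J (J v) = -v
  inner_map_map : ∀ v w, inner ℝ (J v) (J w) = inner ℝ v w

namespace IsOrthogonalComplex

variable {J : E →ₗ[ℝ] E}

theorem inner_right (hJ : IsOrthogonalComplex J) (v w : E) :
    inner ℝ v (J w) = - inner ℝ (J v) w := by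
  have := hJ.inner_map_map v (J w)
  rw [hJ.sq, inner_neg_right] at this
  linarith

theorem inner_self (hJ : IsOrthogonalComplex J) (v : E) : inner ℝ (J v) v = 0 := by
  have := hJ.inner_right v v
  rw [real_inner_comm] at this
  linarith

theorem norm_map (hJ : IsOrthogonalComplex J) (v : E) : ‖J v‖ = ‖v‖ := by
  have := hJ.inner_map_map v v
  rw [real_inner_self_eq_norm_sq, real_inner_self_eq_norm_sq] at this
  exact (sq_eq_sq₀ (norm_nonneg _) (norm_nonneg _)).1 this

theorem injective (hJ : IsOrthogonalComplex J) : Function.Injective J := by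
  intro v w h
  have := congrArg J h
  rwa [hJ.sq, hJ.sq, neg_inj] at this

/-- A positive definite symplectic operator `P` has an invariant isotropic subspace on which it is
at least the identity, and whose orthogonal complement is its image under `J`. -/
theorem exists_invariant_orthogonal_eq [FiniteDimensional ℝ E] (hJ : IsOrthogonalComplex J)
    {P : E →ₗ[ℝ] E} (hP : P.IsSymmetric) (hpos : ∀ v, v ≠ 0 → 0 < inner ℝ (P v) v)
    (hPJ : ∀ v, P (J (P v)) = J v) :
    ∃ W : Submodule ℝ E, (∀ w ∈ W, P w ∈ W) ∧ (∀ w ∈ W, ∀ w' ∈ W, inner ℝ (J w) w' = 0) ∧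
      (∀ w ∈ W, ‖w‖ ^ 2 ≤ inner ℝ (P w) w) ∧ (∀ w ∈ W, ∃ w' ∈ W, P w' = w) ∧ Wᗮ = W.map J := by
  -- `W` is maximal among the invariant isotropic subspaces on which `P ≥ 1`.
  obtain ⟨W, ⟨hinv, hiso, hge⟩, hmax⟩ := (wellFounded_gt (α := Submodule ℝ E)).has_min
    {W | (∀ w ∈ W, P w ∈ W) ∧ (∀ w ∈ W, ∀ w' ∈ W, inner ℝ (J w) w' = 0) ∧
      (∀ w ∈ W, ‖w‖ ^ 2 ≤ inner ℝ (P w) w)} ⟨⊥, by simp +contextual⟩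
  have hPinj : Function.Injective P := by
    rw [← LinearMap.ker_eq_bot, LinearMap.ker_eq_bot']
    intro v hv
    by_contra h0
    simpa [hv] using hpos v h0
  have hsurj (w : E) (hw : w ∈ W) : ∃ w' ∈ W, P w' = w := by
    have hi : Function.Injective (P.restrict hinv) := fun a b hab =>
      Subtype.ext (hPinj (congrArg Subtype.val hab))
    obtain ⟨⟨w', hw'⟩, h⟩ := LinearMap.surjective_of_injective hi ⟨w, hw⟩
    exact ⟨w', hw', congrArg Subtype.val h⟩
  refine ⟨W, hinv, hiso, hge, hsurj, ?_⟩
  -- Otherwise this complement is invariant under `P` and `J` and contains an eigenvector of `P`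
  -- with eigenvalue at least `1`; adjoining it to `W` contradicts maximality.
  have hZ : (W ⊔ W.map J)ᗮ = ⊥ := by
    by_contra hne
    set Z := (W ⊔ W.map J)ᗮ with hZdef
    have memZ (v : E) : v ∈ Z ↔ (∀ w ∈ W, inner ℝ w v = 0) ∧ ∀ w ∈ W, inner ℝ (J w) v = 0 := by
      rw [hZdef, ← Submodule.inf_orthogonal, Submodule.mem_inf, Submodule.mem_orthogonal,
        Submodule.mem_orthogonal]
      simp
    have hZP (v : E) (hv : v ∈ Z) : P v ∈ Z := by
      rw [memZ] at hv ⊢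
      refine ⟨fun w hw => ?_, fun w hw => ?_⟩
      · rw [← hP]; exact hv.1 _ (hinv w hw)
      · obtain ⟨w', hw', rfl⟩ := hsurj w hw
        rw [← hP, hPJ]; exact hv.2 _ hw'
    have hZJ (v : E) (hv : v ∈ Z) : J v ∈ Z := by
      rw [memZ] at hv ⊢
      refine ⟨fun w hw => ?_, fun w hw => ?_⟩
      · rw [hJ.inner_right, hv.2 w hw, neg_zero]
      · rw [hJ.inner_map_map, hv.1 w hw]
    obtain ⟨u, huZ, hu0, a, ha, hua⟩ : ∃ u ∈ Z, u ≠ 0 ∧ ∃ a : ℝ, 1 ≤ a ∧ P u = a • u := by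
      have : Nontrivial Z := Submodule.nontrivial_iff_ne_bot.2 hne
      have hs := hP.restrict_invariant hZP
      obtain ⟨⟨u, huZ⟩, hu⟩ := hs.hasEigenvalue_iSup_of_finiteDimensional.exists_hasEigenvector
      generalize (⨆ x : { x : Z // x ≠ 0 }, _ : ℝ) = a at hu
      have hu0 : u ≠ 0 := fun h => hu.2 (Subtype.ext h)
      have hua : P u = a • u := congrArg Subtype.val hu.apply_eq_smul
      have hapos : 0 < a := by
        have := hpos u hu0
        rw [hua, inner_smul_left, real_inner_self_eq_norm_sq] at this
        exact pos_of_mul_pos_left this (sq_nonneg _)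
      by_cases ha : 1 ≤ a
      · exact ⟨u, huZ, hu0, a, ha, hua⟩
      -- By `P J P = J`, an eigenvalue `a < 1` at `u` becomes `a⁻¹ > 1` at `J u`.
      · refine ⟨J u, hZJ u huZ, fun h => hu0 (hJ.injective (by simpa using h)), a⁻¹,
          (one_le_inv₀ hapos).2 (le_of_not_ge ha), ?_⟩
        have h := hPJ u
        rw [hua, map_smul, map_smul] at h
        rw [eq_inv_smul_iff₀ hapos.ne', h]
    have hu := (memZ u).1 huZ
    refine hmax (W ⊔ ℝ ∙ u) ⟨?_, ?_, ?_⟩ ?_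
    · intro x hx
      obtain ⟨w, hw, c, rfl⟩ := by simpa [Submodule.mem_sup, Submodule.mem_span_singleton] using hx
      rw [map_add, map_smul, hua]
      exact add_mem (Submodule.mem_sup_left (hinv w hw)) (Submodule.mem_sup_right
        (Submodule.smul_mem _ _ (Submodule.smul_mem _ _ (Submodule.mem_span_singleton_self u))))
    · intro x hx x' hx'
      obtain ⟨w, hw, c, rfl⟩ := by simpa [Submodule.mem_sup, Submodule.mem_span_singleton] using hx
      obtain ⟨w', hw', c', rfl⟩ := by
        simpa [Submodule.mem_sup, Submodule.mem_span_singleton] using hx'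
      have h1 : inner ℝ (J u) w' = 0 := by
        have := hJ.inner_right u w'
        rw [real_inner_comm, hu.2 w' hw'] at this
        linarith
      simp only [map_add, map_smul, inner_add_left, inner_add_right, inner_smul_left,
        inner_smul_right, hiso w hw w' hw', hu.2 w hw, hJ.inner_self, h1]
      simp
    · intro x hx
      obtain ⟨w, hw, c, rfl⟩ := by simpa [Submodule.mem_sup, Submodule.mem_span_singleton] using hx
      have h1 : inner ℝ u w = 0 := by rw [real_inner_comm]; exact hu.1 w hw
      rw [← real_inner_self_eq_norm_sq]
      simp only [map_add, map_smul, inner_add_left, inner_add_right, inner_smul_left,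
        inner_smul_right, hu.1 w hw, hu.1 _ (hinv w hw), h1, hua, real_inner_self_eq_norm_sq]
      simp only [conj_trivial, mul_zero, add_zero, zero_add]
      have := hge w hw
      have h2 : c * (c * ‖u‖ ^ 2) ≤ c * (c * (a * ‖u‖ ^ 2)) := by
        have : 0 ≤ (c * ‖u‖) ^ 2 := sq_nonneg _
        nlinarith
      linarith
    · refine lt_of_le_of_ne le_sup_left fun h => hu0 ?_
      have : u ∈ W := by
        rw [h]; exact Submodule.mem_sup_right (Submodule.mem_span_singleton_self u)
      exact inner_self_eq_zero.1 (hu.1 u this)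
  have htop : W ⊔ W.map J = ⊤ := by rwa [Submodule.orthogonal_eq_bot_iff] at hZ
  apply le_antisymm
  · intro v hv
    obtain ⟨w, hw, _, ⟨w', hw', rfl⟩, rfl⟩ := Submodule.mem_sup.1 (htop ▸ Submodule.mem_top : v ∈ _)
    have h := (Submodule.mem_orthogonal _ _).1 hv w hw
    rw [inner_add_right, real_inner_comm, real_inner_comm (J w') w, hiso w' hw' w hw,
      add_zero, inner_self_eq_zero] at h
    rw [h, zero_add]
    exact Submodule.mem_map_of_mem hw'
  · rintro _ ⟨w, hw, rfl⟩
    rw [Submodule.mem_orthogonal]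
    intro w' hw'
    rw [real_inner_comm]
    exact hiso w hw w' hw'

theorem two_mul_finrank_eq [FiniteDimensional ℝ E] (hJ : IsOrthogonalComplex J)
    {W : Submodule ℝ E} (hW : Wᗮ = W.map J) : 2 * Module.finrank ℝ W = Module.finrank ℝ E := by
  have h := W.finrank_add_finrank_orthogonal
  rw [hW, (W.equivMapOfInjective J hJ.injective).finrank_eq.symm] at h
  omega

end IsOrthogonalComplex

open Matrix in
/-- The expansion of a map which does not contract `W`, does not expand `Wᗮ`, and maps them to
orthogonal subspaces is controlled by its determinant on `W`. -/
theorem expansion_le_of_orthogonal [FiniteDimensional ℝ E] (L : E →ₗ[ℝ] G) (W : Submodule ℝ E)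
    (hge : ∀ w ∈ W, ‖w‖ ≤ ‖L w‖) (hle : ∀ v ∈ Wᗮ, ‖L v‖ ≤ ‖v‖)
    (horth : ∀ w ∈ W, ∀ v ∈ Wᗮ, inner ℝ (L w) (L v) = 0) :
    expansion L ≤ √(2 ^ Module.finrank ℝ E) * absDet (L.domRestrict W) := by
  let w := stdOrthonormalBasis ℝ W
  let v := stdOrthonormalBasis ℝ Wᗮ
  let b : Fin (Module.finrank ℝ W) ⊕ Fin (Module.finrank ℝ Wᗮ) → E :=
    Sum.elim (fun i => (w i : E)) (fun i => (v i : E))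
  have hb : Orthonormal ℝ b := by
    rw [orthonormal_iff_ite]
    have hwo := orthonormal_iff_ite.1 w.orthonormal
    have hvo := orthonormal_iff_ite.1 v.orthonormal
    rintro (i | i) (j | j)
    · simpa [b] using hwo i j
    · simpa [b] using Submodule.inner_right_of_mem_orthogonal (w i).2 (v j).2
    · simpa [b] using Submodule.inner_left_of_mem_orthogonal (w j).2 (v i).2
    · simpa [b] using hvo i j
  have hcard : Fintype.card (Fin (Module.finrank ℝ W) ⊕ Fin (Module.finrank ℝ Wᗮ)) =
      Module.finrank ℝ E := by simp [W.finrank_add_finrank_orthogonal]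
  obtain ⟨o, ho⟩ : ∃ o : OrthonormalBasis (Fin (Module.finrank ℝ W) ⊕ Fin (Module.finrank ℝ Wᗮ))
      ℝ E, ⇑o = b := by
    refine ⟨OrthonormalBasis.mk hb ?_, OrthonormalBasis.coe_mk _ _⟩
    rw [hb.linearIndependent.span_eq_top_of_card_eq_finrank' hcard]
  set A := gram ℝ (L.domRestrict W ∘ w) with hA
  set B := gram ℝ (L.domRestrict Wᗮ ∘ v) with hB
  have hblock : gram ℝ (L ∘ o) = fromBlocks A 0 0 B := by
    rw [ho]
    ext (i | i) (j | j)
    · rfl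
    · simpa [b, gram_apply] using horth _ (w i).2 _ (v j).2
    · simpa [b, gram_apply, real_inner_comm] using horth _ (w j).2 _ (v i).2
    · rfl
  have hw1 : gram ℝ w = 1 := by
    ext i j; rw [gram_apply, orthonormal_iff_ite.1 w.orthonormal, one_apply]
  have hv1 : gram ℝ v = 1 := by
    ext i j; rw [gram_apply, orthonormal_iff_ite.1 v.orthonormal, one_apply]
  have hAge : (A - 1).PosSemidef := by
    have := posSemidef_smul_gram_sub w (L.domRestrict W ∘ w) 1 fun x => by
      rw [one_mul]
      refine pow_le_pow_left₀ (norm_nonneg _) ?_ 2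
      simpa using hge _ (∑ i, x i • w i).2
    rwa [one_smul, hw1] at this
  have hBle : (1 - B).PosSemidef := by
    have := posSemidef_smul_gram_sub (L.domRestrict Wᗮ ∘ v) v 1 fun x => by
      rw [one_mul]
      refine pow_le_pow_left₀ (norm_nonneg _) ?_ 2
      simpa using hle _ (∑ i, x i • v i).2
    rwa [one_smul, hv1] at this
  -- From `1 ≤ A` and `B ≤ 1` follow `1 + A ≤ 2 A` and `1 + B ≤ 2`: one factor `2` for each
  -- dimension of `E`.
  have h1 : (1 + A).det ≤ 2 ^ Module.finrank ℝ W * absDet (L.domRestrict W) ^ 2 := by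
    rw [absDet_sq, ← hA]
    have := (PosSemidef.one.add (posSemidef_gram ℝ (L.domRestrict W ∘ w))).det_le_det
      (B := (2 : ℝ) • A) (by convert hAge using 1; rw [two_smul]; abel)
    rwa [det_smul, Fintype.card_fin] at this
  have h2 : (1 + B).det ≤ 2 ^ Module.finrank ℝ Wᗮ := by
    have := (PosSemidef.one.add (posSemidef_gram ℝ (L.domRestrict Wᗮ ∘ v))).det_le_det
      (B := (2 : ℝ) • 1) (by convert hBle using 1; rw [two_smul]; abel)
    rwa [det_smul, Fintype.card_fin, det_one, mul_one] at this
  have h3 : (1 + gram ℝ (L ∘ o)).det = (1 + A).det * (1 + B).det := by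
    rw [hblock, ← fromBlocks_one, fromBlocks_add, add_zero, add_zero, det_fromBlocks_zero₂₁]
  have h4 : 0 ≤ (1 + B).det :=
    (PosSemidef.one.add (posSemidef_gram ℝ (L.domRestrict Wᗮ ∘ v))).det_nonneg
  refine ciSup_le fun W' => le_of_sq_le_sq ?_
    (mul_nonneg (Real.sqrt_nonneg _) (absDet_nonneg _))
  refine (absDet_domRestrict_sq_le_det_one_add L o W').trans ?_
  rw [h3, mul_pow, Real.sq_sqrt (by positivity)]
  calc (1 + A).det * (1 + B).det
      ≤ (2 ^ Module.finrank ℝ W * absDet (L.domRestrict W) ^ 2) * 2 ^ Module.finrank ℝ Wᗮ :=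
        mul_le_mul h1 h2 h4 (by positivity)
    _ = _ := by rw [← W.finrank_add_finrank_orthogonal, pow_add]; ring

/-- The determinant on a subspace `Λ` which projects onto `W` with a lower bound. -/
theorem absDet_domRestrict_ge [FiniteDimensional ℝ E] (L : E →ₗ[ℝ] G) (W Λ : Submodule ℝ E)
    (horth : ∀ w ∈ W, ∀ v ∈ Wᗮ, inner ℝ (L w) (L v) = 0)
    (hdim : Module.finrank ℝ Λ = Module.finrank ℝ W) {δ : ℝ} (hδ : 0 < δ)
    (h : ∀ v ∈ Λ, ∀ u ∈ Wᗮ, δ * ‖v‖ ≤ ‖v - u‖) :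
    absDet (L.domRestrict W) ≤ δ⁻¹ ^ Module.finrank ℝ Λ * absDet (L.domRestrict Λ) := by
  let T : Λ →ₗ[ℝ] W := (W.orthogonalProjectionOnto : E →ₗ[ℝ] W) ∘ₗ Λ.subtype
  have hres (v : E) : v - (W.orthogonalProjectionOnto v : E) ∈ Wᗮ :=
    W.sub_starProjection_mem_orthogonal v
  -- With `p` the projection of `v` to `W`, `L p` and `L (v - p)` are orthogonal, so `‖L p‖ ≤ ‖L
  -- v‖`.
  have h1 : absDet (L.domRestrict W ∘ₗ T) ≤ 1 ^ Module.finrank ℝ Λ * absDet (L.domRestrict Λ) := by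
    refine absDet_le_of_norm_le _ _ zero_le_one fun v => ?_
    set p : E := ((W.orthogonalProjectionOnto (v : E) : W) : E) with hp
    have h2 := horth p (W.orthogonalProjectionOnto (v : E)).2 _ (hres v)
    have h3 : L v = L p + L (v - p) := by rw [← map_add]; simp
    have h4 : ‖L v‖ * ‖L v‖ = _ := h3 ▸ norm_add_sq_eq_norm_sq_add_norm_sq_of_inner_eq_zero _ _ h2
    change ‖L p‖ ≤ 1 * ‖L v‖
    rw [one_mul]
    refine le_of_sq_le_sq ?_ (norm_nonneg _)
    nlinarith [mul_self_nonneg ‖L (v - p)‖]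
  -- Taking `u = v - T v` in `h` gives `δ ‖v‖ ≤ ‖T v‖`.
  have h5 : 1 ≤ δ⁻¹ ^ Module.finrank ℝ Λ * absDet T := by
    rw [← absDet_id (E := Λ)]
    refine absDet_le_of_norm_le _ _ (inv_pos.2 hδ).le fun v => ?_
    have := h v v.2 _ (hres v)
    rw [sub_sub_cancel] at this
    rw [LinearMap.id_apply, inv_mul_eq_div, le_div_iff₀ hδ, mul_comm]
    exact this
  rw [absDet_comp _ _ hdim, one_pow, one_mul] at h1
  have h6 := absDet_nonneg (L.domRestrict W)
  calc absDet (L.domRestrict W) ≤ absDet (L.domRestrict W) * (δ⁻¹ ^ Module.finrank ℝ Λ * absDet T) :=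
        le_mul_of_one_le_right h6 h5
    _ = δ⁻¹ ^ Module.finrank ℝ Λ * (absDet (L.domRestrict W) * absDet T) := by ring
    _ ≤ _ := mul_le_mul_of_nonneg_left h1 (by positivity)

/-- The expansion of a symplectic map is controlled by its determinant on any Lagrangian subspace
which stays away from a suitable isotropic subspace. -/
theorem exists_isotropic_expansion_le [FiniteDimensional ℝ E] [FiniteDimensional ℝ G]
    {J : E →ₗ[ℝ] E} {J' : G →ₗ[ℝ] G} (hJ : IsOrthogonalComplex J) (hJ' : IsOrthogonalComplex J')
    (L : E ≃ₗ[ℝ] G) (hL : ∀ v w, inner ℝ (J' (L v)) (L w) = inner ℝ (J v) w) :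
    ∃ V : Submodule ℝ E, (∀ v ∈ V, ∀ w ∈ V, inner ℝ (J v) w = 0) ∧
      ∀ Λ : Submodule ℝ E, 2 * Module.finrank ℝ Λ = Module.finrank ℝ E → ∀ δ : ℝ, 0 < δ →
        (∀ v ∈ Λ, ∀ u ∈ V, δ * ‖v‖ ≤ ‖v - u‖) →
        expansion (L : E →ₗ[ℝ] G) ≤ √(2 ^ Module.finrank ℝ E) * δ⁻¹ ^ Module.finrank ℝ Λ *
          absDet ((L : E →ₗ[ℝ] G).domRestrict Λ) := by
  let A : G →ₗ[ℝ] E := LinearMap.adjoint (L : E →ₗ[ℝ] G)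
  have hA (v : E) (w : G) : inner ℝ (A w) v = inner ℝ w (L v) :=
    LinearMap.adjoint_inner_left _ _ _
  let P : E →ₗ[ℝ] E := A ∘ₗ L
  have hPin (v w : E) : inner ℝ (P v) w = inner ℝ (L v) (L w) := hA w (L v)
  have hP : P.IsSymmetric := fun v w => by
    rw [hPin, real_inner_comm (P w), hPin, real_inner_comm]
  have hAJL (v : E) : A (J' (L v)) = J v := by
    refine ext_inner_right ℝ fun w => ?_
    rw [hA, hL]
  -- The adjoint of a symplectic map is symplectic; this and `hAJL` give `P J P = J`.
  have hLJA (v : G) : L (J (A v)) = J' v := by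
    obtain ⟨w, hw⟩ := L.surjective (-J' v)
    have hv : v = J' (L w) := by rw [hw, map_neg, hJ'.sq, neg_neg]
    rw [hv, hAJL, hJ.sq, hJ'.sq, map_neg]
  have hPJ (v : E) : P (J (P v)) = J v := by
    rw [← hAJL v, ← hLJA (L v)]
    rfl
  have hpos (v : E) (hv : v ≠ 0) : 0 < inner ℝ (P v) v := by
    rw [hPin, real_inner_self_eq_norm_sq]
    exact pow_pos (norm_pos_iff.2 ((LinearEquiv.map_ne_zero_iff L).2 hv)) 2
  obtain ⟨W, hinv, hiso, hge, hsurj, hW⟩ := hJ.exists_invariant_orthogonal_eq hP hpos hPJ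
  have horth (w : E) (hw : w ∈ W) (v : E) (hv : v ∈ Wᗮ) : inner ℝ (L w) (L v) = 0 := by
    rw [← hPin]
    exact (Submodule.mem_orthogonal _ _).1 hv _ (hinv w hw)
  have hge' (w : E) (hw : w ∈ W) : ‖w‖ ≤ ‖L w‖ := by
    have := hge w hw
    rw [hPin, real_inner_self_eq_norm_sq] at this
    exact le_of_sq_le_sq this (norm_nonneg _)
  -- Every `v ∈ Wᗮ` is `J (P z)` with `z ∈ W`. Then `‖L v‖² = ⟪P z, z⟫ ≤ ‖P z‖ ‖z‖ ≤ ‖P z‖² = ‖v‖²`.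
  have hle (v : E) (hv : v ∈ Wᗮ) : ‖L v‖ ≤ ‖v‖ := by
    rw [hW] at hv
    obtain ⟨w, hw, rfl⟩ := hv
    obtain ⟨z, hz, rfl⟩ := hsurj w hw
    refine le_of_sq_le_sq ?_ (norm_nonneg _)
    have h1 := hge z hz
    have h2 := real_inner_le_norm (P z) z
    have h3 : ‖L (J (P z))‖ ^ 2 = inner ℝ (P z) z := by
      rw [← real_inner_self_eq_norm_sq, ← hPin, hPJ, hJ.inner_map_map, real_inner_comm]
    rw [h3, hJ.norm_map]
    have h4 : ‖z‖ ≤ ‖P z‖ := by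
      by_contra! h
      nlinarith [norm_nonneg (P z), norm_nonneg z]
    nlinarith [norm_nonneg (P z), norm_nonneg z]
  refine ⟨Wᗮ, ?_, fun Λ hΛ δ hδ h => ?_⟩
  · rw [hW]
    rintro _ ⟨v, hv, rfl⟩ _ ⟨w, hw, rfl⟩
    rw [hJ.inner_map_map]
    exact hiso v hv w hw
  · have h1 := expansion_le_of_orthogonal (L : E →ₗ[ℝ] G) W hge' hle horth
    have h2 := absDet_domRestrict_ge (L : E →ₗ[ℝ] G) W Λ horth
      (by have := hJ.two_mul_finrank_eq hW; omega) hδ h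
    refine h1.trans ((mul_le_mul_of_nonneg_left h2 (Real.sqrt_nonneg _)).trans_eq ?_)
    ring

end Symplectic

/-! ### Opticality against isotropic subspaces. -/

/-- A positive curve of Lagrangian subspaces contains no family of unit vectors, one at every time,
spanning an isotropic subspace. -/
theorem IsPositiveAtZero.false_of_isotropic {E : Type*} [NormedAddCommGroup E]
    [InnerProductSpace ℝ E] [FiniteDimensional ℝ E] {σ : E →L[ℝ] E →L[ℝ] ℝ} {α : Submodule ℝ E}
    {Γ : ℝ → Submodule ℝ E} (h : IsPositiveAtZero σ α Γ) (hΓ : Γ 0 = α)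
    (halt : ∀ v, σ v v = 0) (hα : ∀ v ∈ α, ∀ w ∈ α, σ v w = 0) (w : ℝ → E)
    (hw1 : ∀ s, ‖w s‖ = 1) (hw : ∀ s, w s ∈ Γ s) (hσ : ∀ s s', σ (w s) (w s') = 0) : False := by
  obtain ⟨T, T', hT0, -, hT', hev, hpos⟩ := h
  rw [hΓ] at hev hpos
  -- The family `w` need not be continuous; along an ultrafilter it converges by compactness of the
  -- sphere. Time `0` is removed so that difference quotients make sense.
  let 𝒰 : Ultrafilter ℝ := Ultrafilter.of (𝓝[≠] 0)
  have h𝒰 : (𝒰 : Filter ℝ) ≤ 𝓝[≠] 0 := Ultrafilter.of_le _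
  have h𝒰0 : (𝒰 : Filter ℝ) ≤ 𝓝 0 := h𝒰.trans nhdsWithin_le_nhds
  obtain ⟨w₀, hw₀, hlim⟩ : ∃ w₀ ∈ Metric.sphere (0 : E) 1, Tendsto w 𝒰 (𝓝 w₀) := by
    obtain ⟨w₀, h1, h2⟩ := (isCompact_sphere (0 : E) 1).ultrafilter_le_nhds (𝒰.map w)
      (le_principal_iff.2 (Eventually.of_forall (f := (𝒰 : Filter ℝ)) fun s => by simp [hw1]))
    exact ⟨w₀, h1, h2⟩
  have hσ₀ (s : ℝ) : σ (w s) w₀ = 0 :=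
    tendsto_nhds_unique (((σ (w s)).continuous.tendsto w₀).comp hlim)
      (tendsto_const_nhds.congr fun s' => (hσ s s').symm)
  have hζ : ∀ᶠ s in (𝒰 : Filter ℝ), ∃ ζ ∈ α, T s ζ = w s := by
    filter_upwards [h𝒰0 hev] with s hs
    have := hw s
    rw [hs] at this
    exact this
  choose! ζ hζα hζT using fun s (hs : ∃ ζ ∈ α, T s ζ = w s) => hs
  have hTlim : Tendsto (fun s => T s - ContinuousLinearMap.id ℝ E) 𝒰 (𝓝 0) := by
    have := (hT'.continuousAt.tendsto.mono_left h𝒰0).sub_const (ContinuousLinearMap.id ℝ E)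
    rwa [hT0, sub_self] at this
  have hsub : ∀ᶠ s in (𝒰 : Filter ℝ), ‖ζ s - w s‖ ≤ 2 * ‖T s - ContinuousLinearMap.id ℝ E‖ := by
    filter_upwards [hζ, (tendsto_zero_iff_norm_tendsto_zero.1 hTlim).eventually
      (gt_mem_nhds (show (0 : ℝ) < 1 / 2 by norm_num))] with s hs hs2
    have e : w s - ζ s = (T s - ContinuousLinearMap.id ℝ E) (ζ s) := by
      simp [hζT s hs]
    have h1 : ‖w s - ζ s‖ ≤ ‖T s - ContinuousLinearMap.id ℝ E‖ * ‖ζ s‖ :=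
      e ▸ ContinuousLinearMap.le_opNorm _ _
    have h2 : ‖ζ s‖ ≤ ‖w s‖ + ‖w s - ζ s‖ := by
      have := norm_sub_le (w s) (w s - ζ s)
      rwa [sub_sub_cancel] at this
    rw [hw1] at h2
    rw [norm_sub_rev]
    have := norm_nonneg (T s - ContinuousLinearMap.id ℝ E)
    have := norm_nonneg (ζ s)
    have h3 : ‖ζ s‖ ≤ 2 := by nlinarith
    nlinarith
  have hζlim : Tendsto ζ 𝒰 (𝓝 w₀) := by
    have h1 : Tendsto (fun s => ζ s - w s) 𝒰 (𝓝 0) := by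
      refine squeeze_zero_norm' hsub ?_
      simpa using (tendsto_zero_iff_norm_tendsto_zero.1 hTlim).const_mul 2
    simpa using h1.add hlim
  have hw₀α : w₀ ∈ α :=
    (Submodule.closed_of_finiteDimensional α).mem_of_tendsto hζlim (hζ.mono hζα)
  have hslope : Tendsto (fun s => s⁻¹ • (T s - ContinuousLinearMap.id ℝ E)) 𝒰 (𝓝 T') := by
    have := (hasDerivAt_iff_tendsto_slope.1 hT').mono_left h𝒰
    simpa [slope_fun_def, hT0] using this
  -- Here `T s (ζ s) = w s` is `σ`-orthogonal to `w₀` by `hσ₀`, and `ζ s` is so because both lie in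
  -- `α`. In the limit `σ (T' w₀) w₀ = 0`, against positivity.
  have hzero : ∀ᶠ s in (𝒰 : Filter ℝ),
      σ ((s⁻¹ • (T s - ContinuousLinearMap.id ℝ E)) (ζ s)) w₀ = 0 := by
    filter_upwards [hζ] with s hs
    simp [hζT s hs, hσ₀, hα _ (hζα s hs) _ hw₀α]
  have hlim2 : Tendsto (fun s => σ ((s⁻¹ • (T s - ContinuousLinearMap.id ℝ E)) (ζ s)) w₀) 𝒰
      (𝓝 (σ (T' w₀) w₀)) := by
    have h1 := (isBoundedBilinearMap_apply (𝕜 := ℝ) (E := E) (F := E)).continuous.tendsto (T', w₀)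
      |>.comp (hslope.prodMk_nhds hζlim)
    exact ((σ.flip w₀).continuous.tendsto _).comp h1
  have h0 : σ (T' w₀) w₀ = 0 :=
    tendsto_nhds_unique hlim2 (tendsto_const_nhds.congr' (hzero.mono fun s hs => hs.symm))
  have hne : w₀ ≠ 0 := by
    rintro rfl
    simp at hw₀
  have h1 := hpos w₀ ⟨hw₀α, hw₀α⟩ hne
  have h2 := halt (w₀ + T' w₀)
  simp only [map_add, add_apply, halt] at h2
  linarith

/-! ### Limits and compactness in the total space. -/

section FibrePairs

variable {X F : Type*} {S : X → Type*} [∀ x, NormedAddCommGroup (S x)]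
  [∀ x, InnerProductSpace ℝ (S x)]

theorem totalSpace_mk_fibreCast {x y : X} (h : x = y) (v : S x) :
    (⟨y, fibreCast h v⟩ : TotalSpace F S) = ⟨x, v⟩ := by
  subst h; rfl

variable (F S) in
/-- Pairs of vectors in the same fibre. -/
abbrev FibrePairs : Type _ := {q : TotalSpace F S × TotalSpace F S // q.2.proj = q.1.proj}

/-- This permits limits of a fibrewise function of two vectors while the base point moves; it serves
both the metric and the symplectic form. -/
theorem tendsto_fibrePairs [TopologicalSpace (TotalSpace F S)] {ι : Type*} {l : Filter ι} {f : ∀ x, S x → S x → ℝ}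
    (hf : Continuous fun q : FibrePairs F S => f q.1.1.proj q.1.1.2 (fibreCast q.2 q.1.2.2))
    {x : ι → X} {v w : ∀ i, S (x i)} {x₀ : X} {v₀ w₀ : S x₀}
    (hv : Tendsto (fun i => (⟨x i, v i⟩ : TotalSpace F S)) l (𝓝 ⟨x₀, v₀⟩))
    (hw : Tendsto (fun i => (⟨x i, w i⟩ : TotalSpace F S)) l (𝓝 ⟨x₀, w₀⟩)) :
    Tendsto (fun i => f (x i) (v i) (w i)) l (𝓝 (f x₀ v₀ w₀)) := by
  have h : Tendsto (fun i => (⟨(⟨x i, v i⟩, ⟨x i, w i⟩), rfl⟩ : FibrePairs F S)) l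
      (𝓝 ⟨(⟨x₀, v₀⟩, ⟨x₀, w₀⟩), rfl⟩) :=
    tendsto_subtype_rng.2 (hv.prodMk_nhds hw)
  exact (hf.tendsto _).comp h

end FibrePairs

section Bundles

variable {EX H X : Type*} [NormedAddCommGroup EX] [NormedSpace ℝ EX] [TopologicalSpace H]
  {I : ModelWithCorners ℝ EX H} [TopologicalSpace X] [ChartedSpace H X]
  {F : Type*} [NormedAddCommGroup F] [NormedSpace ℝ F]
  {S : X → Type*} [TopologicalSpace (TotalSpace F S)]
  [∀ x, NormedAddCommGroup (S x)] [∀ x, InnerProductSpace ℝ (S x)]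
  [FiberBundle F S] [VectorBundle ℝ F S]

theorem tendsto_inner_bundle [IsContinuousRiemannianBundle F S] {ι : Type*} {l : Filter ι}
    {x : ι → X} {v w : ∀ i, S (x i)} {x₀ : X} {v₀ w₀ : S x₀}
    (hv : Tendsto (fun i => (⟨x i, v i⟩ : TotalSpace F S)) l (𝓝 ⟨x₀, v₀⟩))
    (hw : Tendsto (fun i => (⟨x i, w i⟩ : TotalSpace F S)) l (𝓝 ⟨x₀, w₀⟩)) :
    Tendsto (fun i => inner ℝ (v i) (w i)) l (𝓝 (inner ℝ v₀ w₀)) := by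
  refine tendsto_fibrePairs (f := fun x v w => inner ℝ v w) ?_ hv hw
  refine Continuous.inner_bundle (F := F) (b := fun q : FibrePairs F S => q.1.1.proj) ?_ ?_
  · exact continuous_fst.comp continuous_subtype_val
  · simp_rw [totalSpace_mk_fibreCast]
    exact continuous_snd.comp continuous_subtype_val

theorem SymplecticForm.tendsto (σ : SymplecticForm I F S) {ι : Type*} {l : Filter ι}
    {x : ι → X} {v w : ∀ i, S (x i)} {x₀ : X} {v₀ w₀ : S x₀}
    (hv : Tendsto (fun i => (⟨x i, v i⟩ : TotalSpace F S)) l (𝓝 ⟨x₀, v₀⟩))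
    (hw : Tendsto (fun i => (⟨x i, w i⟩ : TotalSpace F S)) l (𝓝 ⟨x₀, w₀⟩)) :
    Tendsto (fun i => σ.form (x i) (v i) (w i)) l (𝓝 (σ.form x₀ v₀ w₀)) := by
  refine tendsto_fibrePairs (f := fun x v w => σ.form x v w) ?_ hv hw
  rw [continuous_iff_continuousAt]
  intro q
  have h1 : ContinuousAt (fun q : FibrePairs F S => (⟨q.1.1.proj, q.1.1.2⟩ : TotalSpace F S)) q :=
    (continuous_fst.comp continuous_subtype_val).continuousAt
  have h2 : ContinuousAt (fun q : FibrePairs F S =>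
      (⟨q.1.1.proj, fibreCast q.2 q.1.2.2⟩ : TotalSpace F S)) q := by
    simp_rw [totalSpace_mk_fibreCast]
    exact (continuous_snd.comp continuous_subtype_val).continuousAt
  have hb : Continuous (fun q : FibrePairs F S => q.1.1.proj) :=
    (FiberBundle.continuous_proj F S).comp (continuous_fst.comp continuous_subtype_val)
  have := ContinuousAt.clm_bundle_apply₂ (F₁ := F) (F₂ := F) (F₃ := ℝ)
    (E₃ := Bundle.Trivial X ℝ)
    ((σ.contMDiff.continuous.comp hb).continuousAt (x := q)) h1 h2
  simp only [FiberBundle.continuousAt_totalSpace] at this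
  exact this.2

/-- Base points converge along an ultrafilter, and near the limit a trivialization has bounded norm.
Fibre coordinates thus stay in a compact ball of `F`, and continuity of the metric keeps the limit
in the unit ball. -/
theorem isCompact_unitBall [CompactSpace X] [FiniteDimensional ℝ F]
    [IsContinuousRiemannianBundle F S] :
    IsCompact {p : TotalSpace F S | ‖p.2‖ ≤ 1} := by
  rw [isCompact_iff_ultrafilter_le_nhds]
  intro 𝒰 h𝒰
  have hmem : ∀ᶠ p in (𝒰 : Filter (TotalSpace F S)), ‖p.2‖ ≤ 1 :=
    le_principal_iff.1 h𝒰
  obtain ⟨x₀, -, hx₀⟩ := isCompact_univ.ultrafilter_le_nhds (𝒰.map (TotalSpace.proj)) (by simp)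
  have hx : Tendsto TotalSpace.proj (𝒰 : Filter (TotalSpace F S)) (𝓝 x₀) := hx₀
  let e := trivializationAt F S x₀
  have hsrc : ∀ᶠ p in (𝒰 : Filter (TotalSpace F S)), p ∈ e.source := by
    filter_upwards [hx (e.open_baseSet.mem_nhds (FiberBundle.mem_baseSet_trivializationAt' x₀))]
      with p hp
    exact e.mem_source.2 hp
  obtain ⟨C, hC, hbd⟩ := eventually_norm_trivializationAt_lt F S x₀
  obtain ⟨f, -, hf⟩ := (isCompact_closedBall (0 : F) C).ultrafilter_le_nhds
    (𝒰.map fun p => (e p).2) (by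
      simp only [Ultrafilter.coe_map, le_principal_iff, mem_map]
      filter_upwards [hmem, hsrc, hx hbd] with p hp hs hp2
      simp only [Set.mem_preimage, Metric.mem_closedBall, dist_zero_right]
      have h1 := (e.continuousLinearMapAt ℝ p.proj).le_opNorm p.2
      have h2 : e.continuousLinearMapAt ℝ p.proj p.2 = (e p).2 := by
        rw [Trivialization.continuousLinearMapAt_apply,
          Trivialization.coe_linearMapAt_of_mem _ (e.mem_source.1 hs)]
      rw [h2] at h1
      have h3 : ‖e.continuousLinearMapAt ℝ p.proj‖ < C := hp2
      nlinarith [norm_nonneg p.2, norm_nonneg (e.continuousLinearMapAt ℝ p.proj)])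
  have hf' : Tendsto (fun p => (e p).2) (𝒰 : Filter (TotalSpace F S)) (𝓝 f) := hf
  have hlim : Tendsto (fun p : TotalSpace F S => p) 𝒰 (𝓝 (e.toOpenPartialHomeomorph.symm (x₀, f))) := by
    have h1 : Tendsto (fun p => (p.proj, (e p).2)) (𝒰 : Filter (TotalSpace F S)) (𝓝 (x₀, f)) :=
      hx.prodMk_nhds hf'
    have h2 : (x₀, f) ∈ e.target := e.mem_target.2 (FiberBundle.mem_baseSet_trivializationAt' x₀)
    refine ((e.toOpenPartialHomeomorph.continuousAt_symm h2).tendsto.comp h1).congr' ?_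
    filter_upwards [hsrc] with p hp
    have h3 : (p.proj, (e p).2) = e p := by rw [← e.coe_fst hp]
    simp only [Function.comp_apply, h3]
    exact e.toOpenPartialHomeomorph.left_inv hp
  refine ⟨_, ?_, hlim⟩
  have h1 : Tendsto (fun p : TotalSpace F S => inner ℝ p.2 p.2) 𝒰 (𝓝 _) :=
    tendsto_inner_bundle (x := fun p : TotalSpace F S => p.proj) hlim hlim
  have h2 := le_of_tendsto h1 (b := 1) (by
    filter_upwards [hmem] with p hp
    rw [real_inner_self_eq_norm_sq]
    exact pow_le_one₀ (norm_nonneg _) hp)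
  rw [real_inner_self_eq_norm_sq] at h2
  exact (sq_le_one_iff₀ (norm_nonneg _)).1 h2

end Bundles

/-! ### The cocycle on the total space and uniform transversality. -/

section Bundles

variable {EX H X : Type*} [NormedAddCommGroup EX] [NormedSpace ℝ EX] [TopologicalSpace H]
  {I : ModelWithCorners ℝ EX H} [TopologicalSpace X] [ChartedSpace H X]
  {F : Type*} [NormedAddCommGroup F] [NormedSpace ℝ F]
  {S : X → Type*} [TopologicalSpace (TotalSpace F S)]
  [∀ x, NormedAddCommGroup (S x)] [∀ x, InnerProductSpace ℝ (S x)]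
  [FiberBundle F S] [VectorBundle ℝ F S]
  {σ : SymplecticForm I F S} {φ : Flow ℝ X}

theorem IsCompatible.isOrthogonalComplex {J : ∀ x, S x →ₗ[ℝ] S x} (hJ : IsCompatible σ J)
    (x : X) : IsOrthogonalComplex (J x) where
  sq := hJ.sq x
  inner_map_map v w := by rw [hJ.metric, hJ.metric, hJ.invariant]

theorem IsCompatible.inner_map_left {J : ∀ x, S x →ₗ[ℝ] S x} (hJ : IsCompatible σ J)
    (x : X) (v w : S x) : inner ℝ (J x v) w = σ.form x v w := by
  rw [hJ.metric, hJ.invariant]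

theorem IsCompatible.abs_form_le {J : ∀ x, S x →ₗ[ℝ] S x} (hJ : IsCompatible σ J)
    (x : X) (v w : S x) : |σ.form x v w| ≤ ‖v‖ * ‖w‖ := by
  rw [← hJ.inner_map_left, ← (hJ.isOrthogonalComplex x).norm_map v]
  exact abs_real_inner_le_norm _ _

/-- For Lagrangian `W`, `v ∈ Wᗮ` exactly when `J v ∈ W`, so `Wᗮ = J W`. -/
theorem IsCompatible.two_mul_finrank {J : ∀ x, S x →ₗ[ℝ] S x} (hJ : IsCompatible σ J)
    {x : X} [FiniteDimensional ℝ (S x)] {W : Submodule ℝ (S x)} (hW : IsLagrangian (σ.form x) W) :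
    2 * Module.finrank ℝ W = Module.finrank ℝ (S x) := by
  refine (hJ.isOrthogonalComplex x).two_mul_finrank_eq ?_
  have key (v : S x) : v ∈ Wᗮ ↔ J x v ∈ W := by
    rw [hW, Submodule.mem_orthogonal]
    refine forall₂_congr fun w _ => ?_
    rw [← hJ.inner_map_left, (hJ.isOrthogonalComplex x).sq, inner_neg_left, neg_eq_zero,
      real_inner_comm]
  ext v
  rw [key]
  constructor
  · intro h
    refine ⟨-J x v, W.neg_mem h, ?_⟩
    rw [map_neg, hJ.sq, neg_neg]
  · rintro ⟨w, hw, rfl⟩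
    rw [hJ.sq]
    exact W.neg_mem hw

namespace SymplecticCocycle

/-- The action of a cocycle on the total space. -/
def flow (A : SymplecticCocycle σ φ) (t : ℝ) (p : TotalSpace F S) : TotalSpace F S :=
  ⟨φ t p.proj, A.map t p.proj p.2⟩

variable (A : SymplecticCocycle σ φ)

theorem flow_add (t s : ℝ) (p : TotalSpace F S) : A.flow (t + s) p = A.flow t (A.flow s p) :=
  A.map_add t s p.proj p.2

theorem flow_injective (t : ℝ) : Function.Injective (A.flow t) := by
  rintro ⟨x, v⟩ ⟨y, w⟩ h
  obtain rfl : x = y := by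
    have h1 := congrArg (φ (-t)) (congrArg TotalSpace.proj h)
    simpa [flow, ← φ.map_add] using h1
  have h2 := TotalSpace.mk_injective (F := F) (φ t x) h
  rw [show v = w from (A.map t x).injective h2]

/-- The cocycle identity makes the time-zero map idempotent, and it is injective. -/
theorem flow_zero (p : TotalSpace F S) : A.flow 0 p = p :=
  A.flow_injective 0 (by rw [← A.flow_add, add_zero])

theorem flow_neg_flow (t : ℝ) (p : TotalSpace F S) : A.flow (-t) (A.flow t p) = p := by
  rw [← A.flow_add, neg_add_cancel, A.flow_zero]

theorem flow_flow_neg (t : ℝ) (p : TotalSpace F S) : A.flow t (A.flow (-t) p) = p := by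
  rw [← A.flow_add, add_neg_cancel, A.flow_zero]

theorem continuous_flow (t : ℝ) : Continuous (A.flow t) :=
  A.mdifferentiable.continuous.comp (continuous_const.prodMk continuous_id)

/-- Testing membership by flowing back eliminates the cast between fibres. -/
theorem mem_pushforward {α : ∀ x, Submodule ℝ (S x)} {x : X} {s : ℝ} {v : S x} :
    v ∈ A.pushforward α x s ↔ A.map (-s) x v ∈ α (φ (-s) x) := by
  have key (u : S (φ (-s) x)) :
      (⟨x, fibreCast (flow_neg_cancel φ s x) (A.map s _ u)⟩ : TotalSpace F S) =
        A.flow s ⟨φ (-s) x, u⟩ := totalSpace_mk_fibreCast _ _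
  constructor
  · rintro ⟨u, hu, rfl⟩
    have h := congrArg (A.flow (-s)) (key u)
    rw [A.flow_neg_flow] at h
    have h2 : A.map (-s) x (fibreCast (flow_neg_cancel φ s x) (A.map s _ u)) = u :=
      TotalSpace.mk_injective (F := F) (φ (-s) x) h
    change A.map (-s) x (fibreCast (flow_neg_cancel φ s x) (A.map s _ u)) ∈ _
    rwa [h2]
  · intro h
    refine ⟨_, h, TotalSpace.mk_injective (F := F) x ?_⟩
    exact (key _).trans (A.flow_flow_neg s ⟨x, v⟩)

theorem pushforward_zero (α : ∀ x, Submodule ℝ (S x)) (x : X) : A.pushforward α x 0 = α x := by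
  ext v
  rw [mem_pushforward]
  have h : A.flow (-0) ⟨x, v⟩ = ⟨x, v⟩ := by rw [neg_zero, A.flow_zero]
  change (A.flow (-0) ⟨x, v⟩).2 ∈ α (A.flow (-0) ⟨x, v⟩).1 ↔ _
  rw [h]

end SymplecticCocycle

/-- For a Lagrangian subspace, membership means that `σ` vanishes against a frame; with a continuous
frame this passes to limits. -/
theorem isClosed_setOf_mem_distribution {α : ∀ x, Submodule ℝ (S x)}
    (hα : ∀ x, IsLagrangian (σ.form x) (α x)) (hαc : IsContinuousDistribution F α) :
    IsClosed {p : TotalSpace F S | p.2 ∈ α p.1} := by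
  rw [isClosed_iff_ultrafilter]
  rintro ⟨x₀, v₀⟩ 𝒰 h𝒰 hmem
  obtain ⟨U, hU, k, e, he, hspan⟩ := hαc x₀
  have hlim : Tendsto (fun p : TotalSpace F S => p) 𝒰 (𝓝 ⟨x₀, v₀⟩) := h𝒰
  have hx : Tendsto (fun p : TotalSpace F S => p.proj) 𝒰 (𝓝 x₀) :=
    ((FiberBundle.continuous_proj F S).tendsto _).comp hlim
  have h0 (i : Fin k) : σ.form x₀ v₀ (e i x₀) = 0 := by
    have h1 : Tendsto (fun p : TotalSpace F S => (⟨p.proj, e i p.proj⟩ : TotalSpace F S)) 𝒰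
        (𝓝 ⟨x₀, e i x₀⟩) := ((he i).continuousAt hU).tendsto.comp hx
    have h2 := σ.tendsto (x := fun p : TotalSpace F S => p.proj) (v := fun p => p.2) hlim h1
    refine tendsto_nhds_unique h2 (tendsto_const_nhds.congr' ?_)
    filter_upwards [hmem, hx hU] with p hp hpU
    refine (((hα p.proj) p.2).1 hp _ ?_).symm
    rw [← (hspan p.proj hpU).2]
    exact Submodule.subset_span ⟨i, rfl⟩
  change v₀ ∈ α x₀
  rw [hα x₀]
  intro w hw
  rw [← (hspan x₀ (mem_of_mem_nhds hU)).2] at hw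
  induction hw using Submodule.span_induction with
  | mem w hw => obtain ⟨i, rfl⟩ := hw; exact h0 i
  | zero => simp
  | add a b _ _ ha hb => rw [map_add, ha, hb, add_zero]
  | smul c a _ ha => rw [map_smul, ha, smul_zero]

theorem continuous_fibre_norm [IsContinuousRiemannianBundle F S] :
    Continuous fun p : TotalSpace F S => ‖p.2‖ := by
  have h : Continuous fun p : TotalSpace F S => √(inner ℝ p.2 p.2) := by
    refine Real.continuous_sqrt.comp (continuous_iff_continuousAt.2 fun p => ?_)
    exact tendsto_inner_bundle (x := fun p : TotalSpace F S => p.proj) tendsto_id tendsto_id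
  simpa only [real_inner_self_eq_norm_sq, Real.sqrt_sq (norm_nonneg _)] using h

variable [CompactSpace X] [FiniteDimensional ℝ F] [IsContinuousRiemannianBundle F S]

theorem SymplecticCocycle.exists_norm_map_le (A : SymplecticCocycle σ φ) (t : ℝ) :
    ∃ K : ℝ, 1 ≤ K ∧ ∀ x (v : S x), ‖A.map t x v‖ ≤ K * ‖v‖ := by
  obtain ⟨M, hM⟩ := (isCompact_unitBall (F := F) (S := S)).bddAbove_image
    (continuous_fibre_norm.comp (A.continuous_flow t)).continuousOn
  -- A bound at least `1` is what `expansion_le_pow` needs, since subspaces of all dimensions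
  -- compete there.
  refine ⟨max 1 M, le_max_left _ _, fun x v => ?_⟩
  rcases eq_or_ne v 0 with rfl | hv
  · simp
  have h1 : ‖A.map t x (‖v‖⁻¹ • v)‖ ≤ M :=
    hM ⟨⟨x, ‖v‖⁻¹ • v⟩, by simp [norm_smul, hv], rfl⟩
  rw [map_smul, norm_smul, norm_inv, norm_norm, inv_mul_le_iff₀ (norm_pos_iff.2 hv)] at h1
  rw [mul_comm]
  exact h1.trans (mul_le_mul_of_nonneg_left (le_max_right _ _) (norm_nonneg _))

/-- Uniform transversality: among finitely many push-forwards of an optical Lagrangian distribution,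
one stays uniformly away from any given isotropic subspace. -/
theorem SymplecticCocycle.IsOptical.exists_uniform [T2Space X] [∀ x, FiniteDimensional ℝ (S x)]
    {J : ∀ x, S x →ₗ[ℝ] S x} (hJ : IsCompatible σ J) {A : SymplecticCocycle σ φ}
    {α : ∀ x, Submodule ℝ (S x)} (hα : ∀ x, IsLagrangian (σ.form x) (α x))
    (hαc : IsContinuousDistribution F α) (hopt : A.IsOptical α) :
    ∃ (T : Finset ℝ) (δ : ℝ), 0 < δ ∧ ∀ x (V : Submodule ℝ (S x)),
      (∀ u ∈ V, ∀ u' ∈ V, σ.form x u u' = 0) →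
        ∃ s ∈ T, ∀ v ∈ A.pushforward α x s, ∀ u ∈ V, δ * ‖v‖ ≤ ‖v - u‖ := by
  by_contra! hcon
  -- Counterexamples are indexed by a finite set of times and a precision. For each time there is a
  -- unit vector `v s` of the push-forward and a nearby `u s` in the isotropic subspace.
  have hcon' : ∀ q : Finset ℝ × ℕ, ∃ (x : X) (v u : ℝ → S x),
      (∀ s ∈ q.1, ∀ s' ∈ q.1, σ.form x (u s) (u s') = 0) ∧ ∀ s ∈ q.1,
        v s ∈ A.pushforward α x s ∧ ‖v s‖ = 1 ∧ ‖v s - u s‖ ≤ 1 / ((q.2 : ℝ) + 1) := by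
    intro q
    obtain ⟨x, V, hV, h⟩ := hcon q.1 (1 / ((q.2 : ℝ) + 1)) Nat.one_div_pos_of_nat
    have h' : ∀ s : ℝ, ∃ v u : S x, s ∈ q.1 → u ∈ V ∧ v ∈ A.pushforward α x s ∧ ‖v‖ = 1 ∧
        ‖v - u‖ ≤ 1 / ((q.2 : ℝ) + 1) := by
      intro s
      by_cases hs : s ∈ q.1
      · obtain ⟨v, hv, u, hu, hlt⟩ := h s hs
        have hv0 : v ≠ 0 := by
          rintro rfl
          simp only [norm_zero, mul_zero] at hlt
          exact absurd hlt (norm_nonneg _).not_gt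
        have hpos := norm_pos_iff.2 hv0
        refine ⟨‖v‖⁻¹ • v, ‖v‖⁻¹ • u, fun _ => ⟨V.smul_mem _ hu, Submodule.smul_mem _ _ hv, ?_, ?_⟩⟩
        · rw [norm_smul, norm_inv, norm_norm, inv_mul_cancel₀ hpos.ne']
        · rw [← smul_sub, norm_smul, norm_inv, norm_norm, inv_mul_le_iff₀ hpos, mul_comm]
          exact hlt.le
      · exact ⟨0, 0, fun h => absurd h hs⟩
    choose v u hvu using h'
    exact ⟨x, v, u, fun s hs s' hs' => hV _ (hvu s hs).1 _ (hvu s' hs').1, fun s hs => (hvu s hs).2⟩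
  choose x v u hu hv using hcon'
  -- Each real `s` eventually belongs to the finite set, so a single ultrafilter yields limits `w s`
  -- for all the uncountably many times at once.
  let 𝒰 : Ultrafilter (Finset ℝ × ℕ) := Ultrafilter.of atTop
  have h𝒰 : (𝒰 : Filter (Finset ℝ × ℕ)) ≤ atTop := Ultrafilter.of_le _
  have hmem (s : ℝ) : ∀ᶠ q in (𝒰 : Filter (Finset ℝ × ℕ)), s ∈ q.1 := by
    refine h𝒰 ?_
    filter_upwards [eventually_ge_atTop (({s} : Finset ℝ), 0)] with q hq
    exact hq.1 (Finset.mem_singleton_self s)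
  have heps : Tendsto (fun q : Finset ℝ × ℕ => 1 / ((q.2 : ℝ) + 1)) 𝒰 (𝓝 0) := by
    refine (tendsto_one_div_add_atTop_nhds_zero_nat (𝕜 := ℝ)).comp (Tendsto.mono_left ?_ h𝒰)
    rw [← prod_atTop_atTop_eq]
    exact tendsto_snd
  obtain ⟨x₀, -, hx₀⟩ := isCompact_univ.ultrafilter_le_nhds (𝒰.map x) (by simp)
  have hx : Tendsto x 𝒰 (𝓝 x₀) := hx₀
  have hw (s : ℝ) : ∃ w : S x₀,
      Tendsto (fun q => (⟨x q, v q s⟩ : TotalSpace F S)) 𝒰 (𝓝 ⟨x₀, w⟩) := by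
    obtain ⟨⟨y, w⟩, -, hp⟩ := (isCompact_unitBall (F := F) (S := S)).ultrafilter_le_nhds
      (𝒰.map fun q => (⟨x q, v q s⟩ : TotalSpace F S)) (le_principal_iff.2
        (show ∀ᶠ q in (𝒰 : Filter (Finset ℝ × ℕ)), ‖v q s‖ ≤ 1 from
          (hmem s).mono fun q hq => (hv q s hq).2.1.le))
    have hp' : Tendsto (fun q => (⟨x q, v q s⟩ : TotalSpace F S)) 𝒰 (𝓝 ⟨y, w⟩) := hp
    obtain rfl : y = x₀ :=
      tendsto_nhds_unique (((FiberBundle.continuous_proj F S).tendsto _).comp hp') hx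
    exact ⟨w, hp'⟩
  choose w hw using hw
  refine (hopt x₀).false_of_isotropic (A.pushforward_zero α x₀) (σ.alternating x₀)
    (fun a ha b hb => ((hα x₀) a).1 ha b hb) w (fun s => ?_) (fun s => ?_) (fun s s' => ?_)
  · refine tendsto_nhds_unique ((continuous_fibre_norm.tendsto _).comp (hw s))
      (tendsto_const_nhds.congr' ?_)
    filter_upwards [hmem s] with q hq
    exact (hv q s hq).2.1.symm
  · rw [A.mem_pushforward]
    refine (isClosed_setOf_mem_distribution hα hαc).mem_of_tendsto
      (((A.continuous_flow (-s)).tendsto _).comp (hw s)) ?_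
    filter_upwards [hmem s] with q hq
    exact A.mem_pushforward.1 (hv q s hq).1
  · refine tendsto_nhds_unique (σ.tendsto (hw s) (hw s')) (squeeze_zero_norm'
      (a := fun q : Finset ℝ × ℕ => 1 / ((q.2 : ℝ) + 1) +
        (1 + 1 / ((q.2 : ℝ) + 1)) * (1 / ((q.2 : ℝ) + 1))) ?_ ?_)
    · filter_upwards [hmem s, hmem s'] with q hq hq'
      obtain ⟨-, h1, h2⟩ := hv q s hq
      obtain ⟨-, h1', h2'⟩ := hv q s' hq'
      -- As `σ` vanishes on pairs of `u`'s, only error terms remain; they are at most `ε + (1 + ε)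
      -- ε`.
      have e : σ.form (x q) (v q s) (v q s') = σ.form (x q) (v q s - u q s) (v q s') +
          σ.form (x q) (u q s) (v q s' - u q s') := by
        simp [hu q s hq s' hq']
      have h3 : ‖u q s‖ ≤ 1 + 1 / ((q.2 : ℝ) + 1) := by
        have := norm_sub_le (v q s) (v q s - u q s)
        rw [sub_sub_cancel] at this
        linarith
      rw [Real.norm_eq_abs, e]
      refine (abs_add_le _ _).trans (add_le_add ?_ ?_)
      · refine (hJ.abs_form_le _ _ _).trans ?_
        rwa [h1', mul_one]
      · refine (hJ.abs_form_le _ _ _).trans ?_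
        exact mul_le_mul h3 h2' (norm_nonneg _) ((norm_nonneg _).trans h3)
    · simpa using heps.add ((heps.const_add 1).mul heps)

end Bundles

/-! ### Continuity, measurability and integrability of the two functions. -/

-- Any frame computes the determinant as a ratio of Gram determinants; continuous frames then give
-- continuity without a continuous choice of orthonormal bases.
open Matrix in
theorem absDet_domRestrict_of_span_eq {E G : Type*} [NormedAddCommGroup E] [InnerProductSpace ℝ E]
    [NormedAddCommGroup G] [InnerProductSpace ℝ G] [FiniteDimensional ℝ E] (L : E →ₗ[ℝ] G) {k : ℕ}
    {e : Fin k → E} (he : LinearIndependent ℝ e) {W : Submodule ℝ E}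
    (hW : Submodule.span ℝ (Set.range e) = W) :
    absDet (L.domRestrict W) = √((gram ℝ (L ∘ e)).det / (gram ℝ e).det) := by
  subst hW
  have h := det_gram_map (L.domRestrict (Submodule.span ℝ (Set.range e)))
    (fun i => (⟨e i, Submodule.subset_span ⟨i, rfl⟩⟩ : Submodule.span ℝ (Set.range e)))
    (finrank_span_eq_card he).symm
  change (gram ℝ (L ∘ e)).det = (gram ℝ e).det * _ at h
  rw [h, mul_div_cancel_left₀ _ (posDef_gram_of_linearIndependent he).det_pos.ne',
    Real.sqrt_sq (absDet_nonneg _)]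

section Bundles

variable {EX H X : Type*} [NormedAddCommGroup EX] [NormedSpace ℝ EX] [TopologicalSpace H]
  {I : ModelWithCorners ℝ EX H} [TopologicalSpace X] [ChartedSpace H X]
  {F : Type*} [NormedAddCommGroup F] [NormedSpace ℝ F]
  {S : X → Type*} [TopologicalSpace (TotalSpace F S)]
  [∀ x, NormedAddCommGroup (S x)] [∀ x, InnerProductSpace ℝ (S x)]
  [FiberBundle F S] [VectorBundle ℝ F S]
  {σ : SymplecticForm I F S} {φ : Flow ℝ X}

theorem finrank_fibre_eq (F : Type*) [NormedAddCommGroup F] [NormedSpace ℝ F]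
    {S : X → Type*} [TopologicalSpace (TotalSpace F S)]
    [∀ x, NormedAddCommGroup (S x)] [∀ x, InnerProductSpace ℝ (S x)]
    [FiberBundle F S] [VectorBundle ℝ F S] (x : X) :
    Module.finrank ℝ (S x) = Module.finrank ℝ F :=
  ((trivializationAt F S x).linearEquivAt ℝ x
    (FiberBundle.mem_baseSet_trivializationAt' x)).finrank_eq

/-- A basis of a subspace of one fibre extends to a local continuous frame. -/
theorem exists_local_frame {x₀ : X} {k : ℕ} {b : Fin k → S x₀} (hb : LinearIndependent ℝ b) :
    ∃ e : Fin k → ∀ x, S x, (∀ i, e i x₀ = b i) ∧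
      (∀ i, ContinuousAt (fun x => (⟨x, e i x⟩ : TotalSpace F S)) x₀) ∧
      ∀ᶠ x in 𝓝 x₀, LinearIndependent ℝ fun i => e i x := by
  let τ := trivializationAt F S x₀
  have hx₀ : x₀ ∈ τ.baseSet := FiberBundle.mem_baseSet_trivializationAt' x₀
  have hnhds : τ.baseSet ∈ 𝓝 x₀ := τ.open_baseSet.mem_nhds hx₀
  refine ⟨fun i x => τ.symm x (τ ⟨x₀, b i⟩).2, fun i => τ.symm_apply_apply_mk hx₀ _, fun i => ?_, ?_⟩
  · have h1 : ContinuousAt (fun x => τ.toOpenPartialHomeomorph.symm (x, (τ ⟨x₀, b i⟩).2)) x₀ :=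
      ContinuousAt.comp (f := fun x => (x, (τ ⟨x₀, b i⟩).2))
        (τ.toOpenPartialHomeomorph.continuousAt_symm (τ.mem_target.2 hx₀))
        (continuousAt_id.prodMk continuousAt_const)
    refine h1.congr ?_
    filter_upwards [hnhds] with x hx
    exact (τ.mk_symm hx _).symm
  · filter_upwards [hnhds] with x hx
    have h2 := (hb.map' (τ.linearEquivAt ℝ x₀ hx₀ : S x₀ →ₗ[ℝ] F) (LinearEquiv.ker _)).map'
      ((τ.linearEquivAt ℝ x hx).symm : F →ₗ[ℝ] S x) (LinearEquiv.ker _)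
    exact h2

open Matrix in
theorem continuousAt_det_gram [IsContinuousRiemannianBundle F S] {Y : Type*} [TopologicalSpace Y]
    {k : ℕ} {f : Y → X} {e : Fin k → ∀ y, S (f y)} {y₀ : Y}
    (he : ∀ i, ContinuousAt (fun y => (⟨f y, e i y⟩ : TotalSpace F S)) y₀) :
    ContinuousAt (fun y => (gram ℝ fun i => e i y).det) y₀ := by
  have h : ContinuousAt (fun y => gram ℝ fun i => e i y) y₀ :=
    tendsto_pi_nhds.2 fun i => tendsto_pi_nhds.2 fun j => tendsto_inner_bundle (he i) (he j)
  exact ContinuousAt.comp (g := Matrix.det) (Continuous.matrix_det continuous_id).continuousAt h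

variable [∀ x, FiniteDimensional ℝ (S x)]

/-- The determinant on a push-forward of `α` is controlled by the determinant on `α` at an earlier
point of the orbit. -/
theorem SymplecticCocycle.absDet_pushforward_le (A : SymplecticCocycle σ φ)
    (α : ∀ x, Submodule ℝ (S x)) {n : ℕ} (hn : ∀ x, Module.finrank ℝ (α x) = n) {s K K' : ℝ}
    (hK0 : 0 ≤ K) (hK0' : 0 ≤ K') (hK : ∀ x (v : S x), ‖A.map s x v‖ ≤ K * ‖v‖)
    (hK' : ∀ x (v : S x), ‖A.map (-s) x v‖ ≤ K' * ‖v‖) (t : ℝ) (x : X) :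
    Module.finrank ℝ (A.pushforward α x s) = n ∧
    absDet ((A.map t x : S x →ₗ[ℝ] S (φ t x)).domRestrict (A.pushforward α x s)) ≤
      (K * K') ^ n *
        absDet ((A.map t (φ (-s) x) : S (φ (-s) x) →ₗ[ℝ] S (φ t (φ (-s) x))).domRestrict
          (α (φ (-s) x))) := by
  have hdim : Module.finrank ℝ (A.pushforward α x s) = n := by
    rw [← hn (φ (-s) x)]
    exact LinearEquiv.finrank_map_eq _ _
  refine ⟨hdim, ?_⟩
  let M : A.pushforward α x s →ₗ[ℝ] α (φ (-s) x) :=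
    (A.map (-s) x : S x →ₗ[ℝ] S (φ (-s) x)).restrict fun v hv => A.mem_pushforward.1 hv
  set D := (A.map t (φ (-s) x) : S (φ (-s) x) →ₗ[ℝ] S (φ t (φ (-s) x))).domRestrict
    (α (φ (-s) x)) with hD
  have h1 : absDet ((A.map t x : S x →ₗ[ℝ] S (φ t x)).domRestrict (A.pushforward α x s)) ≤
      K ^ n * absDet (D ∘ₗ M) := by
    rw [← hdim]
    refine absDet_le_of_norm_le _ _ hK0 fun v => ?_
    -- Because `t = s + t - s`, the map at time `t` is conjugated by the map at time `s`; only the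
    -- outer two factors are estimated.
    have e : A.flow t ⟨x, v⟩ = A.flow s (A.flow t (A.flow (-s) ⟨x, v⟩)) := by
      rw [← A.flow_add, ← A.flow_add]
      congr 1
      ring
    have e2 : ‖(A.flow t ⟨x, v⟩).2‖ ≤ K * ‖(A.flow t (A.flow (-s) ⟨x, v⟩)).2‖ := by
      rw [e]
      exact hK _ _
    exact e2
  have h2 : absDet M ≤ K' ^ n := by
    rw [← hdim]
    exact absDet_le_pow M hK0' fun v => hK' x v
  rw [absDet_comp D M (hdim.trans (hn _).symm)] at h1
  refine h1.trans ?_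
  rw [mul_pow, mul_assoc]
  refine mul_le_mul_of_nonneg_left ?_ (pow_nonneg hK0 n)
  rw [mul_comm]
  exact mul_le_mul_of_nonneg_right h2 (absDet_nonneg D)

variable [IsContinuousRiemannianBundle F S]

open Matrix in
theorem SymplecticCocycle.continuousAt_absDet (A : SymplecticCocycle σ φ) (t : ℝ) {x₀ : X} {k : ℕ}
    {e : Fin k → ∀ x, S x} (he : ∀ i, ContinuousAt (fun x => (⟨x, e i x⟩ : TotalSpace F S)) x₀)
    {W : ∀ x, Submodule ℝ (S x)}
    (hW : ∀ᶠ x in 𝓝 x₀, LinearIndependent ℝ (fun i => e i x) ∧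
      Submodule.span ℝ (Set.range fun i => e i x) = W x) :
    ContinuousAt (fun x => absDet ((A.map t x : S x →ₗ[ℝ] S (φ t x)).domRestrict (W x))) x₀ := by
  have h1 : ContinuousAt (fun x => (gram ℝ fun i => e i x).det) x₀ := continuousAt_det_gram he
  have h2 : ContinuousAt (fun x => (gram ℝ fun i => A.map t x (e i x)).det) x₀ :=
    continuousAt_det_gram (f := fun x => φ t x) fun i =>
      ContinuousAt.comp (g := A.flow t) (A.continuous_flow t).continuousAt (he i)
  have h3 := (posDef_gram_of_linearIndependent hW.self_of_nhds.1).det_pos.ne'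
  refine ((h2.div h1 h3).sqrt).congr ?_
  filter_upwards [hW] with x hx
  exact (absDet_domRestrict_of_span_eq _ hx.1 hx.2).symm

theorem SymplecticCocycle.continuous_absDet (A : SymplecticCocycle σ φ)
    {α : ∀ x, Submodule ℝ (S x)} (hαc : IsContinuousDistribution F α) (t : ℝ) :
    Continuous fun x => absDet ((A.map t x : S x →ₗ[ℝ] S (φ t x)).domRestrict (α x)) := by
  rw [continuous_iff_continuousAt]
  intro x₀
  obtain ⟨U, hU, k, e, he, hspan⟩ := hαc x₀
  exact A.continuousAt_absDet t (fun i => (he i).continuousAt hU) (mem_of_superset hU hspan)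

/-- A subspace whose determinant exceeds `y` extends to nearby fibres by a local frame, and its
determinant varies continuously. This provides measurability of the expansion. -/
theorem SymplecticCocycle.lowerSemicontinuous_expansion (A : SymplecticCocycle σ φ) (t : ℝ) :
    LowerSemicontinuous fun x => expansion (A.map t x : S x →ₗ[ℝ] S (φ t x)) := by
  intro x₀ y hy
  obtain ⟨W, hW⟩ := exists_lt_of_lt_ciSup hy
  let b := Module.finBasis ℝ W
  have hb : LinearIndependent ℝ (fun i => (b i : S x₀)) :=
    b.linearIndependent.map' W.subtype W.ker_subtype
  obtain ⟨e, he0, hec, hli⟩ := exists_local_frame (F := F) hb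
  have hspan : Submodule.span ℝ (Set.range fun i => e i x₀) = W := by
    simp only [he0]
    have h : (Set.range fun i => (b i : S x₀)) = W.subtype '' Set.range b := by
      rw [← Set.range_comp]; rfl
    rw [h, Submodule.span_image, b.span_eq, Submodule.map_subtype_top]
  have hcont := A.continuousAt_absDet t hec
    (W := fun x => Submodule.span ℝ (Set.range fun i => e i x)) (hli.mono fun x hx => ⟨hx, rfl⟩)
  have h0 : y < absDet ((A.map t x₀ : S x₀ →ₗ[ℝ] S (φ t x₀)).domRestrict
      (Submodule.span ℝ (Set.range fun i => e i x₀))) := by rwa [hspan]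
  filter_upwards [hcont.eventually (lt_mem_nhds h0)] with x hx
  exact hx.trans_le (absDet_domRestrict_le_expansion _ _)

variable [CompactSpace X] [FiniteDimensional ℝ F] [MeasurableSpace X] [BorelSpace X]
  (μ : Measure X) [IsFiniteMeasure μ]

theorem SymplecticCocycle.integrable_expansion (A : SymplecticCocycle σ φ) (t : ℝ) :
    Integrable (fun x => expansion (A.map t x : S x →ₗ[ℝ] S (φ t x))) μ := by
  obtain ⟨K, hK, hbd⟩ := A.exists_norm_map_le t
  refine Integrable.of_bound (A.lowerSemicontinuous_expansion t).measurable.aestronglyMeasurable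
    (K ^ Module.finrank ℝ F) (Eventually.of_forall fun x => ?_)
  rw [Real.norm_of_nonneg (expansion_nonneg _), ← finrank_fibre_eq F (S := S) x]
  exact expansion_le_pow _ hK (hbd x)

theorem SymplecticCocycle.integrable_absDet (A : SymplecticCocycle σ φ)
    {α : ∀ x, Submodule ℝ (S x)} (hαc : IsContinuousDistribution F α) (t : ℝ) :
    Integrable (fun x => absDet ((A.map t x : S x →ₗ[ℝ] S (φ t x)).domRestrict (α x))) μ :=
  (A.integrable_expansion μ t).mono' (A.continuous_absDet hαc t).measurable.aestronglyMeasurable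
    (Eventually.of_forall fun x => by
      rw [Real.norm_of_nonneg (absDet_nonneg _)]
      exact absDet_domRestrict_le_expansion _ _)

end Bundles

/-! ### The integral inequality. -/

theorem proposition1p5
    {EX H X : Type*} [NormedAddCommGroup EX] [NormedSpace ℝ EX] [FiniteDimensional ℝ EX]
    [TopologicalSpace H] (I : ModelWithCorners ℝ EX H)
    [TopologicalSpace X] [ChartedSpace H X] [IsManifold I ∞ X] [CompactSpace X] [T2Space X]
    [MeasurableSpace X] [BorelSpace X]
    {F : Type*} [NormedAddCommGroup F] [NormedSpace ℝ F] [FiniteDimensional ℝ F]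
    {S : X → Type*} [TopologicalSpace (TotalSpace F S)]
    [∀ x, NormedAddCommGroup (S x)] [∀ x, InnerProductSpace ℝ (S x)]
    [∀ x, FiniteDimensional ℝ (S x)]
    [FiberBundle F S] [VectorBundle ℝ F S] [ContMDiffVectorBundle ∞ F S I]
    [IsContinuousRiemannianBundle F S]
    (σ : SymplecticForm I F S) (J : ∀ x, S x →ₗ[ℝ] S x) (hJ : IsCompatible σ J)
    (φ : Flow ℝ X)
    (hφ : ContMDiff (𝓘(ℝ, ℝ).prod I) I ∞ (fun p : ℝ × X => φ p.1 p.2))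
    (μ : Measure X) [IsFiniteMeasure μ] (hμ : ∀ t, MeasurePreserving (φ t) μ μ)
    (A : SymplecticCocycle σ φ)
    (α : ∀ x, Submodule ℝ (S x)) (hα : ∀ x, IsLagrangian (σ.form x) (α x))
    (hαc : IsContinuousDistribution F α)
    (hopt : A.IsOptical α) :
    ∃ C : ℝ, 0 < C ∧ ∀ t : ℝ,
      Integrable (fun x => absDet ((A.map t x : S x →ₗ[ℝ] S (φ t x)).domRestrict (α x))) μ ∧
      Integrable (fun x => expansion (A.map t x : S x →ₗ[ℝ] S (φ t x))) μ ∧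
      C * ∫ x, expansion (A.map t x : S x →ₗ[ℝ] S (φ t x)) ∂μ ≤
        ∫ x, absDet ((A.map t x : S x →ₗ[ℝ] S (φ t x)).domRestrict (α x)) ∂μ := by
  obtain ⟨T, δ, hδ, hT⟩ := hopt.exists_uniform hJ hα hαc
  choose K hK1 hK using A.exists_norm_map_le
  have hK0 (s : ℝ) : 0 ≤ K s := zero_le_one.trans (hK1 s)
  set n := Module.finrank ℝ F / 2 with hn
  have hdim (x : X) : 2 * Module.finrank ℝ (α x) = Module.finrank ℝ F := by
    rw [hJ.two_mul_finrank (hα x), finrank_fibre_eq F]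
  have hαn (x : X) : Module.finrank ℝ (α x) = n := by have := hdim x; omega
  -- The factors come from replacing `ex` by the determinant on `W`, from projecting the
  -- push-forward onto `W`, and from transporting it back to `α`. None involves `t`.
  set c : ℝ → ℝ := fun s => √(2 ^ Module.finrank ℝ F) * δ⁻¹ ^ n * (K s * K (-s)) ^ n with hc
  have hc0 (s : ℝ) : 0 ≤ c s :=
    mul_nonneg (by positivity) (pow_nonneg (mul_nonneg (hK0 _) (hK0 _)) _)
  have hsum : 0 ≤ ∑ s ∈ T, c s := Finset.sum_nonneg fun s _ => hc0 s
  -- The added `1` keeps the constant positive even for empty `T`.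
  refine ⟨(1 + ∑ s ∈ T, c s)⁻¹, inv_pos.2 (by linarith), fun t =>
    ⟨A.integrable_absDet μ hαc t, A.integrable_expansion μ t, ?_⟩⟩
  set g : X → ℝ := fun x => absDet ((A.map t x : S x →ₗ[ℝ] S (φ t x)).domRestrict (α x)) with hg
  have hgi : Integrable g μ := A.integrable_absDet μ hαc t
  have hg0 (x : X) : 0 ≤ g x := absDet_nonneg _
  -- The good time depends on `x`; summing over all of `T` avoids a measurable selection.
  have hpt (x : X) : expansion (A.map t x : S x →ₗ[ℝ] S (φ t x)) ≤
      ∑ s ∈ T, c s * g (φ (-s) x) := by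
    obtain ⟨V, hV, h⟩ := exists_isotropic_expansion_le (hJ.isOrthogonalComplex x)
      (hJ.isOrthogonalComplex (φ t x)) (A.map t x) fun v w => by
        rw [hJ.inner_map_left, hJ.inner_map_left, A.symplectic]
    obtain ⟨s, hs, hsV⟩ := hT x V fun u hu u' hu' => by
      rw [← hJ.inner_map_left]; exact hV u hu u' hu'
    obtain ⟨h1, h2⟩ := A.absDet_pushforward_le α hαn (hK0 s) (hK0 (-s)) (hK s) (hK (-s)) t x
    have h3 := h (A.pushforward α x s) (by
      rw [h1, ← hαn x, hJ.two_mul_finrank (hα x)]) δ hδ hsV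
    rw [h1, finrank_fibre_eq F] at h3
    refine (h3.trans (mul_le_mul_of_nonneg_left h2 (by positivity))).trans ?_
    rw [← mul_assoc]
    exact Finset.single_le_sum (f := fun s => c s * g (φ (-s) x))
      (fun s _ => mul_nonneg (hc0 s) (hg0 _)) hs
  have hgs (s : ℝ) : Integrable (fun x => g (φ s x)) μ := (hμ s).integrable_comp_of_integrable hgi
  have hinv (s : ℝ) : ∫ x, g (φ s x) ∂μ = ∫ x, g x ∂μ := by
    have h := integral_map (hμ s).aemeasurable (f := g)
      (by rw [(hμ s).map_eq]; exact hgi.aestronglyMeasurable)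
    rw [(hμ s).map_eq] at h
    exact h.symm
  have hint : ∫ x, expansion (A.map t x : S x →ₗ[ℝ] S (φ t x)) ∂μ ≤
      (∑ s ∈ T, c s) * ∫ x, g x ∂μ := by
    refine (integral_mono (A.integrable_expansion μ t)
      (integrable_finsetSum _ fun s _ => (hgs (-s)).const_mul (c s)) hpt).trans_eq ?_
    rw [integral_finsetSum _ fun s _ => (hgs (-s)).const_mul (c s), Finset.sum_mul]
    simp only [integral_const_mul, hinv]
  have hgint : 0 ≤ ∫ x, g x ∂μ := integral_nonneg hg0
  rw [inv_mul_le_iff₀ (by linarith)]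
  linarith
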